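/- All graphs are finite and simple. A \emph{block} of a graph is a maximal connected induced subgraph that has no cut vertex of its own; a \emph{block graph} is a graph in which every block is a clique; a graph is \emph{claw-free} if it has no induced subgraph isomorphic to $K_{1,3}$. Let $t\ge 1$ and let $b_1\ge b_2\ge\dots\ge b_t\ge 2$ be integers. Let $\mathcal{G}_{CF}(b_1,\dots,b_t)$ be the set of connected claw-free block graphs whose blocks have orders $b_1,\dots,b_t$ (each block listed once); every such graph has $n=1+\sum_{i=1}^t(b_i-1)$ vertices. A tree $T$ with non-increasing degree sequence $(d_1,\dots,d_N)$ is called a \emph{greedy tree} if it has a root $r$ and an enumeration $v_1,\dots,v_N$ of its vertices with $\deg(v_i)=d_i$ for all $i$, such that the distance from $r$ to $v_i$ is non-decreasing in $i$, and such that, for $i<j$, every child of $v_i$ precedes every child of $v_j$ in the enumeration. (In other words, $T$ is drawn in the plane without crossings, the vertices at distance $\ell$ from the root lie on line $\ell$, and the lines are filled successively, each from left to right, with vertices in non-increasing order of degree.) The Wiener index $W(G)$ of a connected graph $G$ is the sum of the distances over all unordered pairs of vertices, and $L(T)$ denotes the line graph of $T$. Then a greedy tree with degree sequence $(b_1,\dots,b_t,1,\dots,1)$,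 with $n-t+1$ entries $1$ after $b_t$, exists; and for every such greedy tree $T$ one has $L(T)\in\mathcal{G}_{CF}(b_1,\dots,b_t)$ and $$W(L(T))\le W(G)\qquad\text{for all } G\in\mathcal{G}_{CF}(b_1,\dots,b_t).$$ That is, the line graph of the greedy tree minimizes the Wiener index over $\mathcal{G}_{CF}(b_1,\dots,b_t)$. -/

import Mathlib

namespace SteinerWiener

open SimpleGraph

/-- The Wiener index of a finite connected graph: the sum of the distances over all unordered pairs
of vertices (a diagonal pair contributes `0`). -/
noncomputable def wienerIndex {V : Type*} (G : SimpleGraph V) : ℕ :=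
  ∑ᶠ p : Sym2 V, Sym2.lift ⟨fun u v => G.dist u v, fun _ _ => G.dist_comm⟩ p

/-- `v` is a cut vertex of the (finite) graph `G`: deleting `v` increases the number of connected
components. -/
def IsCutVertex {V : Type*} (G : SimpleGraph V) (v : V) : Prop :=
  Nat.card G.ConnectedComponent < Nat.card (G.induce ({v}ᶜ : Set V)).ConnectedComponent

/-- `B` is (the vertex set of) a block of `G`: a maximal connected induced subgraph that has no cut
vertices of its own. -/
def IsBlock {V : Type*} (G : SimpleGraph V) (B : Set V) : Prop :=
  Maximal (fun S : Set V =>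
    (G.induce S).Connected ∧ ∀ v : S, ¬ IsCutVertex (G.induce S) v) B

/-- A block graph is a graph in which every block is a clique. -/
def IsBlockGraph {V : Type*} (G : SimpleGraph V) : Prop :=
  ∀ B : Set V, IsBlock G B → G.IsClique B

/-- No induced subgraph is a claw `K_{1,3}`. -/
def IsClawFree {V : Type*} (G : SimpleGraph V) : Prop :=
  ¬ (completeBipartiteGraph (Fin 1) (Fin 3)).IsIndContained G

/-- `b 0 ≥ b 1 ≥ … ≥ b (t - 1)` are the orders of the blocks of `G`, every block being listed
exactly once. -/
def HasBlockOrderSequence {V : Type*} (G : SimpleGraph V) {t : ℕ} (b : Fin t → ℕ) : Prop :=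
  Antitone b ∧ ∃ B : Fin t ≃ {B : Set V // IsBlock G B}, ∀ i, (B i).1.ncard = b i

/-- The finite connected claw-free block graphs with block order sequence `b`. -/
structure IsClawFreeBlockGraph {V : Type*} (G : SimpleGraph V) {t : ℕ} (b : Fin t → ℕ) :
    Prop where
  finite : Finite V
  connected : G.Connected
  blockGraph : IsBlockGraph G
  clawFree : IsClawFree G
  blockOrder : HasBlockOrderSequence G b

/-- The number `n = 1 + ∑ (bᵢ - 1)` of vertices of a connected block graph whose blocks have the
orders `bᵢ ≥ 1`. -/
def blockGraphOrder {t : ℕ} (b : Fin t → ℕ) : ℕ := 1 + ∑ i, (b i - 1)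

/-- The number `n - t + 1` of entries `1` in the degree sequence attached to `b`. There is no
truncation when all `bᵢ ≥ 2`. -/
def numLeaves {t : ℕ} (b : Fin t → ℕ) : ℕ := blockGraphOrder b - t + 1

/-- The sequence `(b₁, …, b_t, 1, …, 1)`, with `n - t + 1` entries `1` at the end. -/
def treeDegreeSequence {t : ℕ} (b : Fin t → ℕ) : Fin (t + numLeaves b) → ℕ :=
  Fin.append b (fun _ => 1)

/-- `T` is a greedy tree with the non-increasing degree sequence `d`.

The vertices are listed as `v 0, v 1, …` line by line, and from left to right within each line, where
line `i` holds the vertices at distance `i` from the root `r`. By `level_mono` the root comes first.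
By `degree_eq` the vertices receive the degrees in non-increasing order, so that the root has
the largest degree and the lines are filled up successively with the largest degrees that are
left. `planar` says that the edges between consecutive lines do not cross: the children of
a vertex precede the children of each later vertex. -/
def IsGreedyTree {U : Type*} (T : SimpleGraph U) {n : ℕ} (d : Fin n → ℕ) : Prop :=
  T.IsTree ∧ Antitone d ∧ ∃ (v : Fin n ≃ U) (r : U),
    -- degree_eq
    (∀ i, (T.neighborSet (v i)).ncard = d i) ∧
    -- level_mono
    (∀ i j, i ≤ j → T.dist r (v i) ≤ T.dist r (v j)) ∧
    -- planar
    (∀ i j k l, i < j →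
      T.Adj (v i) (v k) → T.dist r (v k) = T.dist r (v i) + 1 →
      T.Adj (v j) (v l) → T.dist r (v l) = T.dist r (v j) + 1 → k < l)

end SteinerWiener

namespace SteinerWiener

open SimpleGraph Finset

/-! Root a connected block graph at a block `B₀` and let k(x) be the number of vertices that x
separates from `B₀`. Every path from u to w passes through each x that has exactly one of u, w
behind it, so d(u,w) is at least 1 plus the number of such x. Double counting
(`sum_sum_one_add_card_separating`) gives 2W(G) ≥ n(n-1) + 2 ∑ k(x)(n-1-k(x)). For the line graph of
a greedy tree, whose vertices are the non-root tree vertices, k becomes the number of strict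
descendants and the opposite inequality holds (`dist_le_one_add_card_descendants`).

It remains to compare two sums of the concave function k(n-1-k). By
`IsClawFreeBlockGraph.exists_centroid` the root block of G can be chosen so that all k(x) ≤ (n-1)/2,
where this function increases. It then suffices that, for every m, the sum of the m smallest values
for G is at least the sum over the last m vertices of the greedy tree
(`sum_mul_sub_le_of_partial_sums_le`).

Both partial sums are compared with `levelSum`. In a claw-free block graph each vertex lies in at
most two blocks, so m vertices closed under going towards `B₀` meet at most m + 1 blocks. These
cover at most `growth b m` vertices (`IsClawFreeBlockGraph.card_le_growth`). Iterating this limits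
how fast a forest of m vertices can be filled level by level and bounds its total depth from below
(`IsClawFreeBlockGraph.levelSum_le`). The greedy tree fills its levels at least at the rate `growth
b`, which bounds its total depth from above (`sum_card_descendants_le`). -/

/-! ### Double counting and inequalities for partial sums -/

theorem two_mul_wienerIndex {V : Type*} [Fintype V] (G : SimpleGraph V) :
    2 * wienerIndex G = ∑ u, ∑ v, G.dist u v := by
  classical
  set f : Sym2 V → ℕ := Sym2.lift ⟨fun u v => G.dist u v, fun _ _ => G.dist_comm⟩ with hf
  have hW : wienerIndex G = ∑ p, f p := finsum_eq_sum_of_fintype _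
  rw [hW, ← Fintype.sum_prod_type', mul_sum]
  have : ∀ q : V × V, G.dist q.1 q.2 = f s(q.1, q.2) := fun q => rfl
  simp_rw [this]
  rw [← Finset.sum_fiberwise_of_maps_to (s := univ) (t := univ)
    (g := fun q : V × V => s(q.1, q.2)) (fun _ _ => mem_univ _)]
  refine sum_congr rfl fun p _ => ?_
  induction p with
  | h a c =>
    by_cases hac : a = c
    · subst hac
      have h0 : f s(a, a) = 0 := by simp [hf]
      rw [h0, mul_zero, eq_comm]
      refine sum_eq_zero fun q hq => ?_
      rw [(mem_filter.1 hq).2, h0]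
    · have : (univ.filter fun q : V × V => s(q.1, q.2) = s(a, c)) = {(a, c), (c, a)} := by
        ext ⟨x, y⟩
        simp
      rw [this, sum_pair (by simp [hac])]
      simp only [Sym2.eq_swap (a := c) (b := a)]
      ring

/-- Summation by parts: a non-increasing weight against non-negative partial sums. -/
theorem mul_sum_le_sum_mul_of_partial_sums_nonneg (c a : ℕ → ℤ) (m : ℕ)
    (hP : ∀ k ≤ m, 0 ≤ ∑ i ∈ range k, a i) (hc : ∀ i j, i ≤ j → j < m → c j ≤ c i)
    (c' : ℤ) (hc' : ∀ i < m, c' ≤ c i) :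
    c' * ∑ i ∈ range m, a i ≤ ∑ i ∈ range m, c i * a i := by
  induction m generalizing c' with
  | zero => simp
  | succ m ih =>
    -- The induction needs an arbitrary lower bound `c'` of the weights: the last weight `c m`
    -- serves as the bound for the earlier ones.
    have h1 := ih (fun k hk => hP k (by omega)) (fun i j hij hj => hc i j hij (by omega)) (c m)
      (fun i hi => hc i m hi.le (by omega))
    have h2 := mul_le_mul_of_nonneg_right (hc' m (by omega)) (hP (m + 1) le_rfl)
    rw [sum_range_succ] at h2 ⊢
    rw [sum_range_succ]
    nlinarith

/-- Monotonicity of `∑ Xᵢ (M - Xᵢ)` under comparison of the partial sums with those of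
a non-decreasing sequence bounded by `M / 2`. -/
theorem sum_mul_sub_le_of_partial_sums_le (X Y : ℕ → ℤ) (M : ℤ) (n : ℕ)
    (hY : ∀ i < n, 2 * Y i ≤ M) (hmono : ∀ i j, i ≤ j → j < n → Y i ≤ Y j)
    (hpre : ∀ k ≤ n, ∑ i ∈ range k, X i ≤ ∑ i ∈ range k, Y i) :
    ∑ i ∈ range n, X i * (M - X i) ≤ ∑ i ∈ range n, Y i * (M - Y i) := by
  have h := mul_sum_le_sum_mul_of_partial_sums_nonneg (fun i => M - 2 * Y i)
    (fun i => Y i - X i) n (fun k hk => by simpa using hpre k hk)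
    (fun i j hij hj => by linarith [hmono i j hij hj]) 0 (fun i hi => by linarith [hY i hi])
  rw [zero_mul] at h
  rw [← sub_nonneg, ← sum_sub_distrib]
  refine h.trans (sum_le_sum fun i _ => ?_)
  -- Y(M - Y) - X(M - X) = (M - 2Y)(Y - X) + (Y - X)², the tangent inequality at Y. Hence `X` need
  -- be neither sorted nor bounded by M / 2.
  nlinarith [sq_nonneg (Y i - X i)]

/-- Double counting of the pairs that are separated by a member of a family of sets. -/
theorem sum_sum_one_add_card_separating {V : Type*} [Fintype V] [DecidableEq V]
    (K : V → Finset V) (hK : ∀ x, x ∉ K x) :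
    (∑ u, ∑ w, if u = w then 0 else
      1 + #{x | x ≠ u ∧ x ≠ w ∧ ¬ (u ∈ K x ↔ w ∈ K x)}) =
    Fintype.card V * (Fintype.card V - 1) +
      2 * ∑ x, #(K x) * (Fintype.card V - 1 - #(K x)) := by
  have h1 : ∀ u w, (if u = w then 0 else
      1 + #{x | x ≠ u ∧ x ≠ w ∧ ¬ (u ∈ K x ↔ w ∈ K x)}) =
      (if u = w then 0 else 1) +
        ∑ x, if x ≠ u ∧ x ≠ w ∧ ¬ (u ∈ K x ↔ w ∈ K x) then 1 else 0 := by
    intro u w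
    split_ifs with h
    · subst h; simp
    · rw [card_filter]
  -- For fixed x, a separated ordered pair has one member in `K x` and the other outside `K x ∪
  -- {x}`.
  have h2 : ∀ x, (∑ u, ∑ w, if x ≠ u ∧ x ≠ w ∧ ¬ (u ∈ K x ↔ w ∈ K x) then 1 else 0) =
      2 * (#(K x) * (Fintype.card V - 1 - #(K x))) := by
    intro x
    set C : Finset V := (insert x (K x))ᶜ with hC
    have hCc : #C = Fintype.card V - 1 - #(K x) := by
      rw [hC, card_compl, card_insert_of_notMem (hK x)]; omega
    rw [← hCc, ← Fintype.sum_prod_type', ← card_filter]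
    have : (univ.filter fun q : V × V => x ≠ q.1 ∧ x ≠ q.2 ∧ ¬ (q.1 ∈ K x ↔ q.2 ∈ K x)) =
        (K x ×ˢ C) ∪ (C ×ˢ K x) := by
      ext ⟨u, w⟩
      have hu : u ∈ K x → x ≠ u := fun h h' => hK x (h' ▸ h)
      have hw : w ∈ K x → x ≠ w := fun h h' => hK x (h' ▸ h)
      simp only [mem_filter, mem_univ, true_and, mem_union, mem_product, hC, mem_compl,
        mem_insert, not_or, eq_comm (b := x)]
      tauto
    rw [this, card_union_of_disjoint, card_product, card_product]
    · ring
    · rw [Finset.disjoint_left]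
      rintro ⟨u, w⟩ h h'
      simp only [mem_product, hC, mem_compl, mem_insert] at h h'
      tauto
  simp_rw [h1, sum_add_distrib]
  congr 1
  · have : ∀ u : V, (∑ w, if u = w then 0 else 1) = Fintype.card V - 1 := by
      intro u
      have : (∑ w, if u = w then 0 else 1) = ∑ w, if w ≠ u then 1 else 0 :=
        sum_congr rfl fun w _ => by by_cases h : u = w <;> simp [h, eq_comm]
      rw [this, ← card_filter, filter_ne', card_erase_of_mem (mem_univ _), card_univ]
    simp [this]
  · rw [mul_sum, ← sum_congr rfl fun x _ => h2 x]
    rw [sum_congr rfl fun u _ => sum_comm]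
    exact sum_comm

theorem sum_card_filter_lt {ι : Type*} (s : Finset ι) (f : ι → ℕ) (J : ℕ) :
    ∑ j ∈ range J, #{u ∈ s | j < f u} = ∑ u ∈ s, min J (f u) := by
  simp_rw [card_filter]
  rw [sum_comm]
  refine sum_congr rfl fun u _ => ?_
  rw [← card_filter]
  have : {j ∈ range J | j < f u} = range (min J (f u)) := by
    ext j; simp
  rw [this, card_range]

theorem sum_le_sum_range_of_antitone (f : ℕ → ℕ) (hf : Antitone f) (Q : Finset ℕ) (q : ℕ)
    (hQ : #Q ≤ q) : ∑ i ∈ Q, f i ≤ ∑ i ∈ range q, f i := by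
  induction q generalizing Q with
  | zero => simp [card_eq_zero.1 (Nat.le_zero.1 hQ)]
  | succ q ih =>
    rw [sum_range_succ]
    by_cases h : ∃ i ∈ Q, q ≤ i
    · obtain ⟨i, hi, hqi⟩ := h
      rw [← sum_erase_add _ _ hi]
      exact add_le_add (ih _ (by rw [card_erase_of_mem hi]; omega)) (hf hqi)
    · push Not at h
      exact (sum_le_sum_of_subset (fun i hi => mem_range.2 (h i hi))).trans
        (Nat.le_add_right _ _)

/-! ### The growth rate determined by the block orders -/

section Growth

variable {t : ℕ}

/-- The number `bᵢ - 1` of vertices that the `i`-th block adds, and `0` beyond the last block. -/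
def excess (b : Fin t → ℕ) (i : ℕ) : ℕ := if h : i < t then b ⟨i, h⟩ - 1 else 0

/-- The order of a union of the `m + 1` largest blocks glued together along a tree. -/
def growth (b : Fin t → ℕ) (m : ℕ) : ℕ := 1 + ∑ i ∈ range (m + 1), excess b i

/-- The total depth of the forest formed by the last `k` of `n` vertices when the lines are filled
as fast as the block orders permit. -/
def levelSum (b : Fin t → ℕ) (n k : ℕ) : ℕ := ∑ j ∈ range n, (n - (growth b)^[j] (n - k))

variable {b : Fin t → ℕ}

theorem excess_antitone (hb : Antitone b) : Antitone (excess b) := by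
  intro i j hij
  unfold excess
  split_ifs with h1 h2
  · exact Nat.sub_le_sub_right (hb hij) 1
  · omega
  · exact Nat.zero_le _
  · exact le_rfl

theorem growth_mono : Monotone (growth b) := fun i j hij =>
  Nat.add_le_add_left (sum_le_sum_of_subset (range_mono (by omega))) 1

theorem sum_range_excess : ∑ i ∈ range t, excess b i = ∑ i, (b i - 1) := by
  rw [← Fin.sum_univ_eq_sum_range]
  exact sum_congr rfl fun i _ => by simp [excess]

theorem sum_range_excess_of_le {m : ℕ} (hm : t ≤ m) :
    ∑ i ∈ range m, excess b i = ∑ i, (b i - 1) := by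
  rw [← sum_range_excess]
  refine (sum_subset (range_mono hm) fun i _ hi => ?_).symm
  have : ¬ i < t := by simpa using hi
  simp [excess, this]

theorem growth_eq_of_le {m : ℕ} (hm : t ≤ m + 1) : growth b m = blockGraphOrder b := by
  rw [growth, sum_range_excess_of_le hm, blockGraphOrder]

theorem growth_le (m : ℕ) : growth b m ≤ blockGraphOrder b := by
  rcases le_total t (m + 1) with h | h
  · exact (growth_eq_of_le h).le
  · rw [← growth_eq_of_le (b := b) (m := t) (by omega)]
    exact growth_mono (by omega)

theorem add_two_le_growth (hb2 : ∀ i, 2 ≤ b i) {m : ℕ} (hm : m < t) : m + 2 ≤ growth b m := by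
  have : ∑ i ∈ range (m + 1), 1 ≤ ∑ i ∈ range (m + 1), excess b i := by
    refine sum_le_sum fun i hi => ?_
    have hi' : i < t := by simp at hi; omega
    have := hb2 ⟨i, hi'⟩
    simp only [excess, hi', dif_pos]
    omega
  simp at this
  unfold growth
  omega

theorem lt_blockGraphOrder (hb2 : ∀ i, 2 ≤ b i) : t < blockGraphOrder b := by
  rcases Nat.eq_zero_or_pos t with rfl | h
  · simp [blockGraphOrder]
  · have := add_two_le_growth hb2 (m := t - 1) (by omega)
    have := growth_le (b := b) (t - 1)
    omega

theorem add_numLeaves (hb2 : ∀ i, 2 ≤ b i) : t + numLeaves b = blockGraphOrder b + 1 := by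
  have := lt_blockGraphOrder hb2
  unfold numLeaves
  omega

theorem treeDegreeSequence_sub_one (i : Fin (t + numLeaves b)) :
    treeDegreeSequence b i - 1 = excess b i := by
  unfold treeDegreeSequence excess
  induction i using Fin.addCases with
  | left i => simp
  | right i => simp

theorem one_le_treeDegreeSequence (hb2 : ∀ i, 2 ≤ b i) (i : Fin (t + numLeaves b)) :
    1 ≤ treeDegreeSequence b i := by
  unfold treeDegreeSequence
  induction i using Fin.addCases with
  | left i => simpa using (hb2 i).trans' one_le_two
  | right i => simp

theorem treeDegreeSequence_antitone (hb : Antitone b) (hb2 : ∀ i, 2 ≤ b i) :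
    Antitone (treeDegreeSequence b) := by
  intro i j hij
  have h := excess_antitone hb (show (i : ℕ) ≤ j from hij)
  rw [← treeDegreeSequence_sub_one, ← treeDegreeSequence_sub_one] at h
  have := one_le_treeDegreeSequence hb2 i
  have := one_le_treeDegreeSequence hb2 j
  omega

end Growth

/-- The `+ 1` turns a number of strict descendants into the size of a subtree, which is what level
counting estimates; it cancels in the comparison. -/
theorem sum_fin_mul_sub_le_of_partial_sums_le {n M : ℕ} (X Y : Fin n → ℕ)
    (hX : ∀ i, X i ≤ M) (hY : ∀ i, 2 * Y i ≤ M) (hmono : Monotone Y)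
    (hpre : ∀ k ≤ n, ∑ i with i.val < k, (X i + 1) ≤ ∑ i with i.val < k, (Y i + 1)) :
    ∑ i, X i * (M - X i) ≤ ∑ i, Y i * (M - Y i) := by
  let ext (Z : Fin n → ℕ) (i : ℕ) : ℤ := if h : i < n then (Z ⟨i, h⟩ : ℤ) else 0
  have hext : ∀ Z (i : Fin n), ext Z i = Z i := fun Z i => by simp [ext]
  have hpart : ∀ Z, ∀ k ≤ n, ((∑ i with i.val < k, (Z i + 1) : ℕ) : ℤ) =
      ∑ i ∈ range k, (ext Z i + 1) := by
    intro Z k hk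
    push_cast
    simp_rw [← hext, sum_filter]
    rw [Fin.sum_univ_eq_sum_range (fun i => if i < k then ext Z i + 1 else 0) n, ← sum_filter]
    congr 1
    ext i; simp; omega
  have htot : ∀ Z : Fin n → ℕ, (∀ i, Z i ≤ M) → ((∑ i, Z i * (M - Z i) : ℕ) : ℤ) =
      ∑ i ∈ range n, ext Z i * (M - ext Z i) := by
    intro Z hZ
    rw [← Fin.sum_univ_eq_sum_range (fun i => ext Z i * (M - ext Z i)) n]
    push_cast
    exact sum_congr rfl fun i _ => by rw [hext, Nat.cast_sub (hZ i)]
  zify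
  have h := sum_mul_sub_le_of_partial_sums_le (ext X) (ext Y) M n
    (fun i hi => by simpa [ext, hi] using mod_cast hY ⟨i, hi⟩)
    (fun i j hij hj => by
      have : i < n := by omega
      simpa [ext, hj, this] using hmono (show (⟨i, this⟩ : Fin n) ≤ ⟨j, hj⟩ from hij))
    (fun k hk => by
      have := Int.ofNat_le.2 (hpre k hk)
      rw [hpart X k hk, hpart Y k hk, sum_add_distrib, sum_add_distrib] at this
      linarith)
  rw [← htot X hX, ← htot Y (fun i => by have := hY i; omega)] at h
  exact_mod_cast h

/-! ### Rooted trees given by a parent function -/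

section ParentFunction

/-- `x` is reached from `i` by iterating the parent function `p`. -/
def IsAncestor (p : ℕ → ℕ) (x i : ℕ) : Prop := ∃ k, p^[k] i = x

theorem isAncestor_iff {p : ℕ → ℕ} {x i : ℕ} :
    IsAncestor p x i ↔ x = i ∨ IsAncestor p x (p i) := by
  constructor
  · rintro ⟨_ | k, h⟩
    · exact Or.inl h.symm
    · exact Or.inr ⟨k, h⟩
  · rintro (rfl | ⟨k, h⟩)
    · exact ⟨0, rfl⟩
    · exact ⟨k + 1, h⟩

theorem IsAncestor.le {p : ℕ → ℕ} (hp : ∀ i, p i ≤ i) {x i : ℕ} (h : IsAncestor p x i) :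
    x ≤ i := by
  obtain ⟨k, rfl⟩ := h
  induction k with
  | zero => exact le_rfl
  | succ k ih =>
    rw [Function.iterate_succ_apply']
    exact (hp _).trans ih

open Classical in
/-- The indices of the strict descendants of `x + 1`, all indices being lowered by one. -/
noncomputable def descendants (p : ℕ → ℕ) {n : ℕ} (x : Fin n) : Finset (Fin n) :=
  {i | i ≠ x ∧ IsAncestor p (x + 1) (i + 1)}

variable {p : ℕ → ℕ} {n : ℕ}

theorem mem_descendants {x i : Fin n} :
    i ∈ descendants p x ↔ i ≠ x ∧ IsAncestor p (x + 1) (i + 1) := by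
  simp [descendants]

theorem notMem_descendants_self (x : Fin n) : x ∉ descendants p x := by simp [mem_descendants]

theorem mem_descendants_of_parent {x j q : Fin n} (hq : (q : ℕ) + 1 = p (j + 1)) (hqj : q < j)
    (hxj : x ≠ j) : j ∈ descendants p x ↔ x = q ∨ q ∈ descendants p x := by
  rw [mem_descendants, mem_descendants, isAncestor_iff, ← hq]
  have h1 : ((x : ℕ) + 1 = j + 1) ↔ x = j := by rw [Fin.ext_iff]; omega
  rw [h1]
  by_cases hxq : x = q
  · subst hxq
    have : IsAncestor p (x + 1) (x + 1) := ⟨0, rfl⟩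
    simp [hxj.symm, this]
  · simp [hxj, hxj.symm, hxq, Ne.symm hxq]

/-- In a rooted tree whose parent function is monotone the distance of two edges is at most one more
than the number of edges between them. -/
theorem dist_le_one_add_card_descendants (hp : ∀ i, 0 < i → p i < i) (hp0 : p 0 = 0)
    (hmono : ∀ i j, 0 < i → i ≤ j → j ≤ n → p i ≤ p j)
    {W : Type*} {H : SimpleGraph W} (e : Fin n → W) (hconn : H.Connected)
    (hsib : ∀ i j : Fin n, i ≠ j → p (i + 1) = p (j + 1) → H.Adj (e i) (e j))
    (hpar : ∀ i j : Fin n, p (j + 1) = i + 1 → H.Adj (e i) (e j)) (i j : Fin n) (hij : i ≠ j) :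
    H.dist (e i) (e j) ≤
      1 + #{x | x ≠ i ∧ x ≠ j ∧ ¬ (i ∈ descendants p x ↔ j ∈ descendants p x)} := by
  have hple : ∀ i, p i ≤ i := fun i => by
    rcases Nat.eq_zero_or_pos i with rfl | h
    · exact hp0.le
    · exact (hp i h).le
  induction hs : (i : ℕ) + j using Nat.strong_induction_on generalizing i j with
  | _ s ih =>
    wlog hlt : i < j generalizing i j with hwlog
    · have h := hwlog j i hij.symm (by omega) (lt_of_le_of_ne (not_lt.1 hlt) hij.symm)
      rw [dist_comm]
      refine h.trans_eq ?_
      congr 2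
      ext x
      simp only [mem_filter, mem_univ, true_and]
      tauto
    have hadj : H.Adj (e i) (e j) → H.dist (e i) (e j) ≤
        1 + #{x | x ≠ i ∧ x ≠ j ∧ ¬ (i ∈ descendants p x ↔ j ∈ descendants p x)} := by
      intro h
      rw [dist_eq_one_iff_adj.2 h]
      exact Nat.le_add_right _ _
    by_cases h1 : p (i + 1) = p (j + 1)
    · exact hadj (hsib i j hij h1)
    have h2 : p (i + 1) < p (j + 1) :=
      lt_of_le_of_ne (hmono _ _ (by omega) (by omega) (by omega)) h1
    have h3 := hp (j + 1) (by omega)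
    obtain ⟨q, hq⟩ : ∃ q : Fin n, (q : ℕ) + 1 = p (j + 1) :=
      ⟨⟨p (j + 1) - 1, by omega⟩, by simp; omega⟩
    have hqj : q < j := by rw [Fin.lt_def]; omega
    by_cases h4 : q = i
    · exact hadj (hpar i j (by rw [← hq, h4]))
    have h5 := ih (i + q) (by omega) i q (Ne.symm h4) rfl
    have h6 : H.dist (e i) (e j) ≤ H.dist (e i) (e q) + H.dist (e q) (e j) := hconn.dist_triangle
    rw [dist_eq_one_iff_adj.2 (hpar q j hq.symm)] at h6
    have hiq : i ∉ descendants p q := by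
      rw [mem_descendants]
      rintro ⟨hne, hanc⟩
      rw [isAncestor_iff] at hanc
      rcases hanc with h | h
      · exact hne (Fin.ext (by omega))
      · have := h.le hple
        omega
    -- Replacing the later edge j by its parent edge q removes exactly one unit from the bound: q
    -- has j but not i below it, and any other x that separates i from q separates i from j.
    have hsub : insert q (univ.filter fun x =>
        x ≠ i ∧ x ≠ q ∧ ¬ (i ∈ descendants p x ↔ q ∈ descendants p x)) ⊆
        univ.filter fun x =>
          x ≠ i ∧ x ≠ j ∧ ¬ (i ∈ descendants p x ↔ j ∈ descendants p x) := by
      intro x hx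
      rw [mem_insert] at hx
      rcases hx with rfl | hx
      · have := (mem_descendants_of_parent hq hqj hqj.ne).2 (Or.inl rfl)
        simp [h4, hqj.ne, this, hiq]
      · simp only [mem_filter, mem_univ, true_and] at hx ⊢
        obtain ⟨hxi, hxq, hx⟩ := hx
        have hxj : x ≠ j := by
          rintro rfl
          refine hx (iff_of_false ?_ ?_) <;> rw [mem_descendants] <;> rintro ⟨-, h⟩
          · have := h.le hple
            omega
          · have := h.le hple
            omega
        rw [mem_descendants_of_parent hq hqj hxj]
        refine ⟨hxi, hxj, ?_⟩
        simpa [hxq] using hx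
    have h7 := card_le_card hsub
    rw [card_insert_of_notMem (by simp)] at h7
    omega

/-- The last `k` subtrees of a tree whose lines are filled at the rate `growth b` have total size at
most `levelSum b n k`. -/
theorem sum_card_descendants_le {t : ℕ} {b : Fin t → ℕ} (hp : ∀ i, 0 < i → p i < i)
    (hp0 : p 0 = 0) (hgrow : ∀ i m, 0 < i → i ≤ n → i ≤ growth b m → p i ≤ m) (k : ℕ) :
    ∑ x : Fin n with n - k ≤ x.val, (#(descendants p x) + 1) ≤ levelSum b n k := by
  classical
  have hple : ∀ i, p i ≤ i := fun i => by
    rcases Nat.eq_zero_or_pos i with rfl | h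
    · exact hp0.le
    · exact (hp i h).le
  set lev : ℕ → ℕ := fun m => #{x : Fin n | n - k ≤ x ∧ IsAncestor p (x + 1) m} with hlev
  have hlev0 : ∀ m ≤ n - k, lev m = 0 := by
    intro m hm
    simp only [hlev, card_eq_zero]
    refine filter_eq_empty_iff.2 fun x _ h => ?_
    have := h.2.le hple
    omega
  have hlev1 : ∀ m, lev m ≤ lev (p m) + 1 := by
    intro m
    by_cases hm : ∃ y : Fin n, (y : ℕ) + 1 = m
    · obtain ⟨y, rfl⟩ := hm
      refine (card_le_card (t := insert y (univ.filter
        fun x : Fin n => n - k ≤ x ∧ IsAncestor p (x + 1) (p (y + 1)))) fun x hx => ?_).trans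
        (card_insert_le _ _)
      simp only [mem_filter, mem_univ, true_and, mem_insert] at hx ⊢
      rcases isAncestor_iff.1 hx.2 with h | h
      · exact Or.inl (Fin.ext (by omega))
      · exact Or.inr ⟨hx.1, h⟩
    · refine (card_le_card fun x hx => ?_).trans (Nat.le_succ _)
      simp only [mem_filter, mem_univ, true_and] at hx ⊢
      refine ⟨hx.1, (isAncestor_iff.1 hx.2).resolve_left fun h => hm ⟨x, h⟩⟩
  -- Indices up to n - k lie below none of the last k vertices. Passing to the parent lowers `lev`
  -- by at most one and, by `hgrow`, undoes one application of `growth b`.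
  have hlevle : ∀ j m, m ≤ n → m ≤ (growth b)^[j] (n - k) → lev m ≤ j := by
    intro j
    induction j with
    | zero => intro m _ hm; exact (hlev0 m hm).le
    | succ j ih =>
      intro m hmn hm
      rcases Nat.eq_zero_or_pos m with rfl | hpos
      · rw [hlev0 0 (Nat.zero_le _)]; exact Nat.zero_le _
      rw [Function.iterate_succ_apply'] at hm
      have := ih (p m) ((hple m).trans hmn) (hgrow m _ hpos hmn hm)
      have := hlev1 m
      omega
  have h1 : ∀ x : Fin n, #(descendants p x) + 1 =
      ∑ i : Fin n, if IsAncestor p (x + 1) (i + 1) then 1 else 0 := by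
    intro x
    rw [← card_filter, ← card_insert_of_notMem (notMem_descendants_self (p := p) x)]
    congr 1
    ext i
    simp only [mem_insert, mem_descendants, mem_filter, mem_univ, true_and]
    by_cases h : i = x
    · subst h
      have : IsAncestor p (i + 1) (i + 1) := ⟨0, rfl⟩
      simp [this]
    · simp [h]
  simp_rw [h1]
  rw [sum_comm]
  have h2 : ∀ i : Fin n, (∑ x : Fin n with n - k ≤ x.val,
      if IsAncestor p (x + 1) (i + 1) then 1 else 0) = min n (lev (i + 1)) := by
    intro i
    rw [← card_filter, filter_filter, min_eq_right]
    exact (card_le_univ _).trans_eq (by simp)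
  rw [sum_congr rfl fun i _ => h2 i, ← sum_card_filter_lt, levelSum]
  refine sum_le_sum fun j _ => ?_
  rw [← Nat.card_Ico]
  refine card_le_card_of_injOn Fin.val (fun i hi => ?_) Fin.val_injective.injOn
  simp only [coe_filter, mem_univ, true_and, Set.mem_ofPred_eq] at hi
  simp only [coe_Ico, Set.mem_Ico]
  refine ⟨?_, i.2⟩
  by_contra h
  have := hlevle j (i + 1) (by omega) (by omega)
  omega

end ParentFunction

/-- Geodesics from r to a and to c, prolonged to u, are two paths from r to u; in a tree they
coincide, and so do their penultimate vertices. -/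
theorem eq_of_adj_of_dist_add_one {U : Type*} {T : SimpleGraph U} (hT : T.IsTree) {r u a c : U}
    (ha : T.Adj a u) (hc : T.Adj c u) (hda : T.dist r u = T.dist r a + 1)
    (hdc : T.dist r u = T.dist r c + 1) : a = c := by
  obtain ⟨pa, hpa, hla⟩ := hT.connected.exists_path_of_dist r a
  obtain ⟨pc, hpc, hlc⟩ := hT.connected.exists_path_of_dist r c
  have h1 : (pa.concat ha).IsPath :=
    Walk.isPath_of_length_eq_dist _ (by rw [Walk.length_concat, hla, hda])
  have h2 : (pc.concat hc).IsPath :=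
    Walk.isPath_of_length_eq_dist _ (by rw [Walk.length_concat, hlc, hdc])
  have h3 := congrArg Subtype.val
    ((hT.isAcyclic.subsingleton_path r u).elim ⟨pa.concat ha, h1⟩ ⟨pc.concat hc, h2⟩)
  have h4 := congrArg Walk.penultimate h3
  simpa using h4

/-! ### Existence of the greedy tree -/

section GreedyTree

variable {t : ℕ} {b : Fin t → ℕ}

/-- The index of the parent of the `i`-th vertex of the greedy tree. -/
noncomputable def greedyParent (b : Fin t → ℕ) (i : ℕ) : ℕ := sInf {m | i ≤ growth b m}

/-- The vertices 0, …, m are meant to have the children 1, …, `growth b m`, because the root has one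
child more than its excess. The bound on i keeps the set nonempty; the infimum of the empty set
would be 0. -/
theorem greedyParent_le_iff {i m : ℕ} (hi : i ≤ blockGraphOrder b) :
    greedyParent b i ≤ m ↔ i ≤ growth b m := by
  have hne : {m | i ≤ growth b m}.Nonempty := ⟨t, by simpa [growth_eq_of_le] using hi⟩
  constructor
  · intro h
    exact (Nat.sInf_mem hne).trans (growth_mono h)
  · intro h
    exact Nat.sInf_le h

theorem greedyParent_lt (hb2 : ∀ i, 2 ≤ b i) {i : ℕ} (hi : 0 < i)
    (hin : i ≤ blockGraphOrder b) : greedyParent b i < i := by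
  have : greedyParent b i ≤ i - 1 := by
    rw [greedyParent_le_iff hin]
    rcases lt_or_ge (i - 1) t with h | h
    · have := add_two_le_growth hb2 h
      omega
    · rw [growth_eq_of_le (by omega)]
      exact hin
  omega

theorem greedyParent_mono {i j : ℕ} (hij : i ≤ j) (hj : j ≤ blockGraphOrder b) :
    greedyParent b i ≤ greedyParent b j := by
  rw [greedyParent_le_iff (hij.trans hj)]
  exact hij.trans ((greedyParent_le_iff hj).1 le_rfl)

variable (b) in
/-- The tree on `0, …, N - 1` in which every positive `i` is joined to `greedyParent b i`. -/
def greedyGraph (N : ℕ) : SimpleGraph (Fin N) where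
  Adj i j := i ≠ j ∧
    ((0 < j.val ∧ greedyParent b j = i) ∨ (0 < i.val ∧ greedyParent b i = j))
  symm := ⟨fun _ _ h => ⟨h.1.symm, h.2.symm⟩⟩
  loopless := ⟨fun _ h => h.1 rfl⟩

variable {N : ℕ}

theorem greedyGraph_adj_iff (hb2 : ∀ i, 2 ≤ b i) (hN : N = blockGraphOrder b + 1)
    {i j : Fin N} : (greedyGraph b N).Adj i j ↔
      (0 < j.val ∧ greedyParent b j = i) ∨ (0 < i.val ∧ greedyParent b i = j) := by
  refine ⟨fun h => h.2, fun h => ⟨?_, h⟩⟩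
  rintro rfl
  have h' : 0 < i.val ∧ greedyParent b i = i := by tauto
  have := greedyParent_lt hb2 h'.1 (by omega)
  omega

theorem greedyGraph_isTree (hb2 : ∀ i, 2 ≤ b i) (hN : N = blockGraphOrder b + 1) :
    (greedyGraph b N).IsTree := by
  have : NeZero N := ⟨by omega⟩
  have hreach : ∀ m, ∀ i : Fin N, i.val = m → (greedyGraph b N).Reachable 0 i := by
    intro m
    induction m using Nat.strong_induction_on with
    | _ m ih =>
      intro i hi
      rcases Nat.eq_zero_or_pos m with rfl | hm
      · rw [show i = 0 from Fin.ext hi]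
      · have hlt := greedyParent_lt hb2 hm (by omega)
        refine (ih _ hlt ⟨greedyParent b m, by omega⟩ rfl).trans (Adj.reachable ?_)
        rw [greedyGraph_adj_iff hb2 hN]
        left
        simp [hi, hm]
  have hconn : (greedyGraph b N).Connected :=
    (connected_iff _).2 ⟨fun i j => (hreach _ i rfl).symm.trans (hreach _ j rfl), ⟨0⟩⟩
  rw [isTree_iff_connected_and_card]
  refine ⟨hconn, le_antisymm ?_ hconn.card_vert_le_card_edgeSet_add_one⟩
  have hadj : ∀ i : Fin (blockGraphOrder b), (greedyGraph b N).Adj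
      ⟨i + 1, by omega⟩ ⟨greedyParent b (i + 1), by
        have := greedyParent_lt hb2 (i := i + 1) (by omega) (by omega); omega⟩ := by
    intro i
    rw [greedyGraph_adj_iff hb2 hN]
    right
    simp
  -- Each edge joins some positive vertex to its parent, so there are at most N - 1 edges; a
  -- connected graph with so few edges is a tree.
  let f : Fin (blockGraphOrder b) → (greedyGraph b N).edgeSet :=
    fun i => ⟨_, (mem_edgeSet _).2 (hadj i)⟩
  have hf : Function.Surjective f := by
    rintro ⟨e, he⟩
    have key : ∀ i j : Fin N, 0 < i.val → greedyParent b i = j → ∃ k, (f k).1 = s(i, j) := by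
      intro i j hi hij
      refine ⟨⟨i - 1, by omega⟩, ?_⟩
      have h1 : i.val - 1 + 1 = i.val := by omega
      simp [f, h1, hij]
    induction e with
    | h i j =>
      rw [mem_edgeSet, greedyGraph_adj_iff hb2 hN] at he
      rcases he with he | he
      · obtain ⟨k, hk⟩ := key j i he.1 he.2
        exact ⟨k, Subtype.ext (hk.trans Sym2.eq_swap)⟩
      · obtain ⟨k, hk⟩ := key i j he.1 he.2
        exact ⟨k, Subtype.ext hk⟩
  have := Nat.card_le_card_of_surjective f hf
  simp at this ⊢
  omega

theorem greedyGraph_dist [NeZero N] (hb2 : ∀ i, 2 ≤ b i) (hN : N = blockGraphOrder b + 1)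
    {i j : Fin N} (hi : 0 < i.val) (hij : greedyParent b i = j) :
    (greedyGraph b N).dist 0 i = (greedyGraph b N).dist 0 j + 1 := by
  have hT := greedyGraph_isTree hb2 hN
  induction hm : i.val using Nat.strong_induction_on generalizing i j with
  | _ m ih =>
    have hlt := greedyParent_lt hb2 hi (by omega)
    have hadj : (greedyGraph b N).Adj i j :=
      (greedyGraph_adj_iff hb2 hN).2 (Or.inr ⟨hi, hij⟩)
    rcases hT.dist_eq_dist_add_one_of_adj 0 hadj with h | h
    · exact h
    exfalso
    -- If j were farther from the root than its child i, then i and the parent of j would both be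
    -- the unique neighbour of j nearer to the root, although i > j > `greedyParent b j`.
    have hj : 0 < j.val := by
      rw [Nat.pos_iff_ne_zero]
      intro h0
      rw [show j = 0 from Fin.ext h0] at h
      simp at h
    have hlt' := greedyParent_lt hb2 hj (by omega)
    set k : Fin N := ⟨greedyParent b j, by omega⟩ with hk
    have h2 := ih j (by omega) (j := k) hj rfl rfl
    have hadj' : (greedyGraph b N).Adj k j :=
      (greedyGraph_adj_iff hb2 hN).2 (Or.inl ⟨hj, rfl⟩)
    have h3 := eq_of_adj_of_dist_add_one hT hadj hadj' h h2
    have h4 : i.val = greedyParent b j := congrArg Fin.val h3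
    omega

theorem greedyGraph_isGreedyTree (hb : Antitone b) (hb2 : ∀ i, 2 ≤ b i) :
    IsGreedyTree (greedyGraph b (t + numLeaves b)) (treeDegreeSequence b) := by
  have hN := add_numLeaves hb2
  have : NeZero (t + numLeaves b) := ⟨by omega⟩
  refine ⟨greedyGraph_isTree hb2 hN, treeDegreeSequence_antitone hb hb2, Equiv.refl _, 0,
    ?_, ?_, ?_⟩
  · intro i
    have hd : treeDegreeSequence b i = 1 + excess b i := by
      have := treeDegreeSequence_sub_one i
      have := one_le_treeDegreeSequence hb2 i
      omega
    have hin : i.val ≤ blockGraphOrder b := by omega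
    rw [Equiv.refl_apply, hd, ← Set.ncard_image_of_injective _ Fin.val_injective]
    rcases Nat.eq_zero_or_pos i.val with h0 | hpos
    · have : Fin.val '' (greedyGraph b (t + numLeaves b)).neighborSet i =
          (Ioc 0 (growth b 0) : Finset ℕ) := by
        ext m
        simp only [Set.mem_image, mem_neighborSet, greedyGraph_adj_iff hb2 hN, coe_Ioc,
          Set.mem_Ioc, h0, lt_irrefl, false_and, or_false]
        constructor
        · rintro ⟨j, ⟨hj, hji⟩, rfl⟩
          exact ⟨hj, (greedyParent_le_iff (by omega)).1 hji.le⟩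
        · rintro ⟨hm, hm'⟩
          have hmn := hm'.trans (growth_le 0)
          exact ⟨⟨m, by omega⟩, ⟨hm, Nat.le_zero.1 ((greedyParent_le_iff hmn).2 hm')⟩, rfl⟩
      rw [this, Set.ncard_coe_finset, Nat.card_Ioc, h0]
      simp [growth]
    · have hlt := greedyParent_lt hb2 hpos hin
      have hchild : ∀ m ≤ blockGraphOrder b, (greedyParent b m = i ↔
          growth b (i - 1) < m ∧ m ≤ growth b i) := by
        intro m hm
        rw [← greedyParent_le_iff hm, ← not_le, ← greedyParent_le_iff hm]
        omega
      have : Fin.val '' (greedyGraph b (t + numLeaves b)).neighborSet i =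
          (insert (greedyParent b i) (Ioc (growth b (i - 1)) (growth b i)) : Finset ℕ) := by
        ext m
        simp only [Set.mem_image, mem_neighborSet, greedyGraph_adj_iff hb2 hN, coe_insert,
          coe_Ioc, Set.mem_insert_iff, Set.mem_Ioc]
        constructor
        · rintro ⟨j, ⟨hj, hji⟩ | ⟨-, hij⟩, rfl⟩
          · exact Or.inr ((hchild _ (by omega)).1 hji)
          · exact Or.inl hij.symm
        · rintro (rfl | hm)
          · exact ⟨⟨greedyParent b i, by omega⟩, Or.inr ⟨hpos, rfl⟩, rfl⟩
          · have hmn := hm.2.trans (growth_le _)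
            exact ⟨⟨m, by omega⟩, Or.inl ⟨by simp; omega, (hchild m hmn).2 hm⟩, rfl⟩
      rw [this, Set.ncard_coe_finset, card_insert_of_notMem, Nat.card_Ioc]
      · have : growth b i = growth b (i - 1) + excess b i := by
          unfold growth
          rw [sum_range_succ, Nat.sub_add_cancel hpos]
          ring
        omega
      · intro h
        rw [mem_Ioc] at h
        have := (hchild _ (by omega)).2 h
        have := greedyParent_mono hlt.le hin
        omega
  · intro i j hij
    simp only [Equiv.refl_apply]
    induction hm : j.val using Nat.strong_induction_on generalizing i j with
    | _ m ih =>
      rcases Nat.eq_zero_or_pos i.val with h0 | hpos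
      · rw [show i = 0 from Fin.ext h0]
        simp
      · have hij' : i.val ≤ j.val := hij
        have hlt := greedyParent_lt hb2 (i := j) (by omega) (by omega)
        have hlti := greedyParent_lt hb2 hpos (by omega)
        rw [greedyGraph_dist hb2 hN hpos (j := ⟨greedyParent b i, by omega⟩) rfl,
          greedyGraph_dist hb2 hN (i := j) (by omega) (j := ⟨greedyParent b j, by omega⟩) rfl]
        refine Nat.succ_le_succ (ih (greedyParent b j) (by omega) _ _ ?_ rfl)
        exact greedyParent_mono hij (by omega)
  · intro i j k l hij hik hdk hjl hdl
    simp only [Equiv.refl_apply] at *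
    have key : ∀ {i k : Fin (t + numLeaves b)}, (greedyGraph b (t + numLeaves b)).Adj i k →
        (greedyGraph b (t + numLeaves b)).dist 0 k =
          (greedyGraph b (t + numLeaves b)).dist 0 i + 1 → greedyParent b k = i := by
      intro i k hik hdk
      rcases (greedyGraph_adj_iff hb2 hN).1 hik with h | h
      · exact h.2
      · have := greedyGraph_dist hb2 hN h.1 h.2
        omega
    have h1 := key hik hdk
    have h2 := key hjl hdl
    by_contra hkl
    have := greedyParent_mono (b := b) (show l.val ≤ k.val from not_lt.1 hkl) (by omega)
    have : i.val < j.val := hij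
    omega

end GreedyTree

/-! ### The line graph of a greedy tree: upper bound for the Wiener index -/

theorem lineGraph_adj_of_mem {U : Type*} {T : SimpleGraph U} {e f : T.edgeSet} (hne : e ≠ f)
    {u : U} (he : u ∈ e.1) (hf : u ∈ f.1) : T.lineGraph.Adj e f :=
  ⟨hne, u, he, hf⟩

theorem lineGraph_connected {U : Type*} {T : SimpleGraph U} (hT : T.Connected)
    (hne : T.edgeSet.Nonempty) : T.lineGraph.Connected := by
  have hshare : ∀ (e f : T.edgeSet) (u : U), u ∈ e.1 → u ∈ f.1 → T.lineGraph.Reachable e f := by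
    intro e f u he hf
    by_cases h : e = f
    · rw [h]
    · exact (lineGraph_adj_of_mem h he hf).reachable
  have key : ∀ (u w : U) (_ : T.Walk u w) (e f : T.edgeSet), u ∈ e.1 → w ∈ f.1 →
      T.lineGraph.Reachable e f := by
    intro u w q
    induction q with
    | nil => exact fun e f he hf => hshare e f _ he hf
    | @cons u x w h q ih =>
      intro e f he hf
      exact (hshare e ⟨s(u, x), h⟩ u he (Sym2.mem_mk_left _ _)).trans
        (ih _ f (Sym2.mem_mk_right _ _) hf)
  refine (connected_iff _).2 ⟨fun e f => ?_, hne.to_subtype⟩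
  obtain ⟨u, hu⟩ : ∃ u, u ∈ e.1 := ⟨_, Sym2.out_fst_mem _⟩
  obtain ⟨w, hw⟩ : ∃ w, w ∈ f.1 := ⟨_, Sym2.out_fst_mem _⟩
  obtain ⟨q⟩ := hT.preconnected u w
  exact key u w q e f hu hw

theorem exists_adj_dist_eq_add_one {U : Type*} {T : SimpleGraph U} (hT : T.Connected) {r u : U}
    (h : u ≠ r) : ∃ a, T.Adj a u ∧ T.dist r u = T.dist r a + 1 := by
  obtain ⟨q, hq⟩ := hT.exists_walk_length_eq_dist u r
  cases q with
  | nil => exact absurd rfl h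
  | @cons _ a _ hadj q =>
    refine ⟨a, hadj.symm, ?_⟩
    have h1 : T.dist a r ≤ q.length := dist_le q
    have h2 : T.dist u r ≤ T.dist u a + T.dist a r := hT.dist_triangle
    rw [dist_eq_one_iff_adj.2 hadj] at h2
    rw [Walk.length_cons] at hq
    rw [dist_comm, dist_comm (u := r)]
    omega

/-- The parent function of a greedy tree, and the resulting enumeration of its edges. -/
theorem IsGreedyTree.exists_parent {t : ℕ} {b : Fin t → ℕ} (hb2 : ∀ i, 2 ≤ b i)
    {U : Type*} {T : SimpleGraph U} (hG : IsGreedyTree T (treeDegreeSequence b)) :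
    ∃ (p : ℕ → ℕ) (e : Fin (blockGraphOrder b) ≃ T.edgeSet),
      (∀ i, 0 < i → p i < i) ∧ p 0 = 0 ∧
      (∀ i j, 0 < i → i ≤ j → j ≤ blockGraphOrder b → p i ≤ p j) ∧
      (∀ i m, 0 < i → i ≤ blockGraphOrder b → i ≤ growth b m → p i ≤ m) ∧
      (∀ i j : Fin (blockGraphOrder b), i ≠ j → p (i + 1) = p (j + 1) →
        T.lineGraph.Adj (e i) (e j)) ∧
      (∀ i j : Fin (blockGraphOrder b), p (j + 1) = i + 1 → T.lineGraph.Adj (e i) (e j)) := by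
  obtain ⟨hT, -, v, r, hdeg, hlev, hplanar⟩ := hG
  have hN := add_numLeaves hb2
  set n := blockGraphOrder b with hn
  have : NeZero (t + numLeaves b) := ⟨by omega⟩
  have hv0 : v 0 = r := by
    have h := hlev 0 (v.symm r) (Fin.zero_le _)
    rw [Equiv.apply_symm_apply, SimpleGraph.dist_self] at h
    exact ((hT.connected.dist_eq_zero_iff).1 (Nat.le_zero.1 h)).symm
  have hex : ∀ i : Fin (t + numLeaves b), ∃ q : Fin (t + numLeaves b), 0 < i.val →
      T.Adj (v q) (v i) ∧ T.dist r (v i) = T.dist r (v q) + 1 := by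
    intro i
    rcases Nat.eq_zero_or_pos i.val with h | h
    · exact ⟨0, fun h' => absurd h' (by omega)⟩
    · obtain ⟨a, ha⟩ := exists_adj_dist_eq_add_one hT.connected (r := r) (u := v i) (by
        rw [← hv0, v.injective.ne_iff]
        rintro rfl
        simp at h)
      exact ⟨v.symm a, fun _ => by simpa using ha⟩
  choose q hq using hex
  have hpos : ∀ i j : Fin (t + numLeaves b), T.dist r (v i) = T.dist r (v j) + 1 → 0 < i.val := by
    intro i j h
    rw [Nat.pos_iff_ne_zero]
    intro h0
    rw [show i = 0 from Fin.ext h0, hv0, SimpleGraph.dist_self] at h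
    omega
  have huniq : ∀ i j : Fin (t + numLeaves b), T.Adj (v j) (v i) →
      T.dist r (v i) = T.dist r (v j) + 1 → q i = j := by
    intro i j hadj hd
    have h := hq i (hpos i j hd)
    exact v.injective (eq_of_adj_of_dist_add_one hT h.1 hadj h.2 hd)
  have hadj_cases : ∀ i j : Fin (t + numLeaves b), T.Adj (v i) (v j) →
      (0 < i.val ∧ q i = j) ∨ (0 < j.val ∧ q j = i) := by
    intro i j h
    rcases hT.dist_eq_dist_add_one_of_adj r h with h' | h'
    · exact Or.inl ⟨hpos _ _ h', huniq _ _ h.symm h'⟩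
    · exact Or.inr ⟨hpos _ _ h', huniq _ _ h h'⟩
  have hqlt : ∀ i : Fin (t + numLeaves b), 0 < i.val → q i < i := by
    intro i hi
    by_contra h
    have h1 := hlev i (q i) (not_lt.1 h)
    have h2 := (hq i hi).2
    omega
  -- This is planarity read backwards: parents in the wrong order would force their children into
  -- the wrong order.
  have hqmono : ∀ i j : Fin (t + numLeaves b), 0 < i.val → i ≤ j → q i ≤ q j := by
    intro i j hi hij
    by_contra h
    have hj : 0 < j.val := lt_of_lt_of_le hi hij
    have := hplanar _ _ j i (not_le.1 h) (hq j hj).1 (hq j hj).2 (hq i hi).1 (hq i hi).2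
    exact absurd hij (not_le.2 this)
  have hchild : ∀ a : Fin (t + numLeaves b), excess b a + (if a.val = 0 then 1 else 0) ≤
      #{j : Fin (t + numLeaves b) | 0 < j.val ∧ q j = a} := by
    intro a
    have hd : treeDegreeSequence b a = 1 + excess b a := by
      have := treeDegreeSequence_sub_one a
      have := one_le_treeDegreeSequence hb2 a
      omega
    have hsub : v.symm '' T.neighborSet (v a) ⊆
        ((if a.val = 0 then ∅ else {q a}) ∪
          (univ.filter fun j : Fin (t + numLeaves b) => 0 < j.val ∧ q j = a) :
            Finset (Fin (t + numLeaves b))) := by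
      rintro _ ⟨u, hu, rfl⟩
      have hu' : T.Adj (v a) (v (v.symm u)) := by simpa using hu
      rcases hadj_cases _ _ hu' with h | h
      · have := h.1.ne'
        simp [this, h.2]
      · exact mem_coe.2 (mem_union_right _ (mem_filter.2 ⟨mem_univ _, h⟩))
    have hcard := Set.ncard_le_ncard hsub (Finset.finite_toSet _)
    rw [Set.ncard_image_of_injective _ v.symm.injective, hdeg, hd, Set.ncard_coe_finset] at hcard
    have := hcard.trans (card_union_le _ _)
    split_ifs at this ⊢ with h
    · rw [card_empty] at this; omega
    · rw [card_singleton] at this; omega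
  -- If the parent of i came after m, monotonicity would place every child of the vertices 0, …, m
  -- before i, at indices from 1 to i - 1; but by `hchild` there are at least `growth b m` ≥ i of
  -- them.
  have hgrow : ∀ (i : Fin (t + numLeaves b)) (m : ℕ), 0 < i.val →
      i.val ≤ growth b m → (q i).val ≤ m := by
    intro i m hi him
    by_contra hlt
    push Not at hlt
    have hle : growth b m ≤ #{j : Fin (t + numLeaves b) | 0 < j.val ∧ (q j).val ≤ m} := by
      have h1 : #{j : Fin (t + numLeaves b) | 0 < j.val ∧ (q j).val ≤ m} =
          ∑ a ∈ range (m + 1), #{j : Fin (t + numLeaves b) | 0 < j.val ∧ (q j).val = a} := by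
        rw [card_eq_sum_card_fiberwise (f := fun j => (q j).val) (t := range (m + 1))]
        · refine sum_congr rfl fun a ha => ?_
          rw [filter_filter]
          congr 1
          ext j
          simp at ha ⊢
          omega
        · intro j hj
          simp at hj ⊢
          omega
      have h2 : growth b m = ∑ a ∈ range (m + 1), (excess b a + if a = 0 then 1 else 0) := by
        rw [growth, sum_add_distrib, sum_ite_eq']
        simp [add_comm]
      rw [h1, h2]
      refine sum_le_sum fun a ha => ?_
      have haN : a < (t + numLeaves b) := by
        have := (q i).2
        simp at ha
        omega
      refine (hchild ⟨a, haN⟩).trans_eq ?_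
      simp [Fin.ext_iff]
    have hle2 : #{j : Fin (t + numLeaves b) | 0 < j.val ∧ (q j).val ≤ m} ≤ i - 1 := by
      rw [← Nat.card_Ico]
      refine card_le_card_of_injOn Fin.val (fun j hj => ?_) Fin.val_injective.injOn
      simp only [coe_filter, mem_univ, true_and, Set.mem_ofPred_eq] at hj
      simp only [coe_Ico, Set.mem_Ico]
      refine ⟨hj.1, ?_⟩
      by_contra h
      have : (q i).val ≤ (q j).val := hqmono i j hi (not_lt.1 h)
      omega
    omega
  let p : ℕ → ℕ := fun i => if h : 0 < i ∧ i < (t + numLeaves b) then (q ⟨i, h.2⟩).val else 0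
  have hp : ∀ i : Fin (t + numLeaves b), 0 < i.val → p i = q i := fun i hi => by simp [p, hi]
  let s : Fin n → Fin (t + numLeaves b) := fun i => ⟨i + 1, by omega⟩
  have hs : ∀ i, 0 < (s i).val := fun i => Nat.succ_pos _
  have hsinj : ∀ i j, s i = s j → i = j := fun i j h => by
    have : i.val + 1 = j.val + 1 := congrArg Fin.val h
    exact Fin.ext (by omega)
  -- Edges are indexed by their lower endpoint, shifted by one since the root has no parent edge.
  let f : Fin n → T.edgeSet := fun i => ⟨s(v (q (s i)), v (s i)), (hq (s i) (hs i)).1⟩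
  have hfinj : Function.Injective f := by
    intro i j h
    have h' := congrArg Subtype.val h
    simp only [f, Sym2.eq_iff, v.injective.eq_iff] at h'
    rcases h' with h' | h'
    · exact hsinj _ _ h'.2
    · have h1 := hqlt _ (hs i)
      have h2 := hqlt _ (hs j)
      rw [h'.1] at h1
      rw [← h'.2] at h2
      exact absurd h1 h2.asymm
  have hfsurj : Function.Surjective f := by
    have key : ∀ i j : Fin (t + numLeaves b), 0 < i.val → q i = j → ∃ k, (f k).1 = s(v j, v i) := by
      intro i j hi hij
      refine ⟨⟨i - 1, by omega⟩, ?_⟩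
      have h1 : s ⟨i - 1, by omega⟩ = i := Fin.ext (by simp [s]; omega)
      simp [f, h1, hij]
    rintro ⟨e, he⟩
    induction e with
    | h x y =>
      have he' : T.Adj (v (v.symm x)) (v (v.symm y)) := by simpa using he
      rcases hadj_cases _ _ he' with h | h
      · obtain ⟨k, hk⟩ := key _ _ h.1 h.2
        exact ⟨k, Subtype.ext (hk.trans (by simp [Sym2.eq_swap]))⟩
      · obtain ⟨k, hk⟩ := key _ _ h.1 h.2
        exact ⟨k, Subtype.ext (hk.trans (by simp))⟩
  refine ⟨p, Equiv.ofBijective f ⟨hfinj, hfsurj⟩, ?_, by simp [p], ?_, ?_, ?_, ?_⟩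
  · intro i hi
    by_cases h : i < (t + numLeaves b)
    · rw [hp ⟨i, h⟩ hi]
      exact hqlt ⟨i, h⟩ hi
    · simpa [p, h] using hi
  · intro i j hi hij hj
    rw [hp ⟨i, by omega⟩ hi, hp ⟨j, by omega⟩ (by simp; omega)]
    exact hqmono ⟨i, _⟩ ⟨j, _⟩ hi hij
  · intro i m hi hin him
    rw [hp ⟨i, by omega⟩ hi]
    exact hgrow ⟨i, by omega⟩ m hi him
  · intro i j hij h
    have h' : q (s i) = q (s j) :=
      Fin.ext (((hp (s i) (hs i)).symm.trans h).trans (hp (s j) (hs j)))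
    refine lineGraph_adj_of_mem (u := v (q (s i))) (hfinj.ne hij) (Sym2.mem_mk_left _ _) ?_
    rw [h']
    exact Sym2.mem_mk_left _ _
  · intro i j h
    have h' : q (s j) = s i := Fin.ext ((hp (s j) (hs j)).symm.trans h)
    have hij : i ≠ j := by
      rintro rfl
      exact (hqlt _ (hs i)).ne h'
    refine lineGraph_adj_of_mem (u := v (s i)) (hfinj.ne hij) (Sym2.mem_mk_right _ _) ?_
    rw [← h']
    exact Sym2.mem_mk_left _ _

theorem IsGreedyTree.two_mul_wienerIndex_lineGraph_le {t : ℕ} {b : Fin t → ℕ}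
    (hb2 : ∀ i, 2 ≤ b i) {U : Type*} {T : SimpleGraph U}
    (hG : IsGreedyTree T (treeDegreeSequence b)) :
    ∃ X : Fin (blockGraphOrder b) → ℕ,
      (∀ i, X i ≤ blockGraphOrder b - 1) ∧
      (∀ k, ∑ i with i.val < k, (X i + 1) ≤ levelSum b (blockGraphOrder b) k) ∧
      2 * wienerIndex T.lineGraph ≤ blockGraphOrder b * (blockGraphOrder b - 1) +
        2 * ∑ i, X i * (blockGraphOrder b - 1 - X i) := by
  obtain ⟨p, e, hp, hp0, hmono, hgrow, hsib, hpar⟩ := hG.exists_parent hb2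
  have hn : 0 < blockGraphOrder b := by unfold blockGraphOrder; omega
  have hconn : T.lineGraph.Connected :=
    lineGraph_connected hG.1.connected ⟨_, (e ⟨0, hn⟩).2⟩
  -- The order is reversed so that the first k entries belong to the last k vertices.
  refine ⟨fun i => #(descendants p i.rev), fun i => ?_, fun k => ?_, ?_⟩
  · have h := card_le_card (subset_univ (insert i.rev (descendants p i.rev)))
    rw [card_insert_of_notMem (notMem_descendants_self _), card_univ, Fintype.card_fin] at h
    simp only
    omega
  · refine le_trans (le_of_eq ?_) (sum_card_descendants_le hp hp0 hgrow k)
    refine sum_nbij' Fin.rev Fin.rev ?_ ?_ ?_ ?_ ?_ <;> simp <;> omega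
  · have : Fintype T.edgeSet := Fintype.ofEquiv _ e
    rw [two_mul_wienerIndex, ← Equiv.sum_comp e]
    simp_rw [← Equiv.sum_comp e]
    have h := sum_sum_one_add_card_separating (descendants p (n := blockGraphOrder b))
      notMem_descendants_self
    rw [Fintype.card_fin] at h
    have hrev := Equiv.sum_comp Fin.revPerm
      fun i : Fin (blockGraphOrder b) =>
        #(descendants p i) * (blockGraphOrder b - 1 - #(descendants p i))
    simp only [Fin.revPerm_apply] at hrev
    rw [hrev]
    refine le_trans (sum_le_sum fun i _ => sum_le_sum fun j _ => ?_) h.le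
    split_ifs with hij
    · simp [hij]
    · exact dist_le_one_add_card_descendants hp hp0 hmono e hconn hsib hpar i j hij

end SteinerWiener

namespace SteinerWiener

open SimpleGraph

/-! ### Nonseparable sets and the blocks of the line graph of a tree -/

/-- The induced subgraph on `S` is connected and has no cut vertex. -/
def IsNonseparable {V : Type*} (G : SimpleGraph V) (S : Set V) : Prop :=
  (G.induce S).Connected ∧ ∀ v : S, ¬ IsCutVertex (G.induce S) v

theorem isBlock_iff {V : Type*} {G : SimpleGraph V} {B : Set V} :
    IsBlock G B ↔ IsNonseparable G B ∧ ∀ S, IsNonseparable G S → B ⊆ S → S = B := by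
  refine ⟨fun h => ⟨h.1, fun S hS hBS => ?_⟩, fun h => ⟨h.1, fun S hS hBS => ?_⟩⟩
  · exact (h.2 hS hBS).antisymm hBS
  · exact (h.2 S hS hBS).le

theorem not_isCutVertex_of_preconnected {V : Type*} {H : SimpleGraph V} {v : V}
    (hH : H.Connected) (h : (H.induce ({v}ᶜ : Set V)).Preconnected) : ¬ IsCutVertex H v := by
  have := h.subsingleton_connectedComponent
  have := hH.preconnected.subsingleton_connectedComponent
  have : Nonempty H.ConnectedComponent := hH.nonempty.map H.connectedComponentMk
  have h1 : Nat.card H.ConnectedComponent = 1 := Nat.card_eq_one_iff_unique.2 ⟨‹_›, ‹_›⟩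
  have h2 : Nat.card (H.induce ({v}ᶜ : Set V)).ConnectedComponent ≤ 1 :=
    Finite.card_le_one_iff_subsingleton.2 ‹_›
  unfold IsCutVertex
  omega

/-- Finiteness matters here: `Nat.card` of an infinite set of components would be 0. -/
theorem preconnected_of_not_isCutVertex {V : Type*} [Finite V] {H : SimpleGraph V} {v : V}
    (hH : H.Connected) (h : ¬ IsCutVertex H v) : (H.induce ({v}ᶜ : Set V)).Preconnected := by
  have := hH.preconnected.subsingleton_connectedComponent
  have h1 : Nat.card H.ConnectedComponent ≤ 1 := Finite.card_le_one_iff_subsingleton.2 ‹_›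
  have h2 : Nat.card (H.induce ({v}ᶜ : Set V)).ConnectedComponent ≤ 1 := (not_lt.1 h).trans h1
  have := Finite.card_le_one_iff_subsingleton.1 h2
  exact fun x y => ConnectedComponent.exact (Subsingleton.elim _ _)

theorem isNonseparable_of_isClique {V : Type*} {G : SimpleGraph V} {S : Set V}
    (hS : G.IsClique S) (hne : S.Nonempty) : IsNonseparable G S := by
  have := hne.to_subtype
  have htop : G.induce S = ⊤ := induce_eq_top.2 hS
  have hconn : (G.induce S).Connected := (connected_iff _).2 ⟨by rw [htop]; simp, this⟩
  refine ⟨hconn, fun v => not_isCutVertex_of_preconnected hconn ?_⟩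
  rw [htop]
  intro x y
  by_cases h : x = y
  · rw [h]
  · exact Adj.reachable (by simpa [Subtype.ext_iff] using h)

theorem IsNonseparable.exists_isBlock_superset {V : Type*} [Finite V] {G : SimpleGraph V}
    {S : Set V} (hS : IsNonseparable G S) : ∃ B, S ⊆ B ∧ IsBlock G B :=
  (Set.toFinite {S : Set V | IsNonseparable G S}).exists_le_maximal hS

section LineGraph

variable {U : Type*} {T : SimpleGraph U}

/-- The set of edges at `u`, as vertices of the line graph. -/
def edgeStar (T : SimpleGraph U) (u : U) : Set T.edgeSet := {e | u ∈ e.1}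

theorem isClique_edgeStar (u : U) : T.lineGraph.IsClique (edgeStar T u) :=
  fun _ he _ hf hne => lineGraph_adj_of_mem hne he hf

theorem eq_of_mem_of_mem_edges {e f : T.edgeSet} (hne : e ≠ f) {u w : U} (hue : u ∈ e.1)
    (huf : u ∈ f.1) (hwe : w ∈ e.1) (hwf : w ∈ f.1) : u = w := by
  by_contra h
  exact hne (Subtype.ext (((Sym2.mem_and_mem_iff h).1 ⟨hue, hwe⟩).trans
    ((Sym2.mem_and_mem_iff h).1 ⟨huf, hwf⟩).symm))

/-- In the line graph of a forest, a vertex separates its non-adjacent neighbours. -/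
theorem isClique_of_isNonseparable_lineGraph [Finite U] (hT : T.IsAcyclic) {S : Set T.edgeSet}
    (hS : IsNonseparable T.lineGraph S) : T.lineGraph.IsClique S := by
  intro e he f hf hne
  by_contra hnadj
  have : Finite T.edgeSet := inferInstance
  obtain ⟨q, hq⟩ := hS.1.exists_walk_length_eq_dist ⟨e, he⟩ ⟨f, hf⟩
  have hne' : (⟨e, he⟩ : S) ≠ ⟨f, hf⟩ := fun h => hne (congrArg Subtype.val h)
  -- A shortest walk between non-adjacent vertices contains an induced path on three vertices; its
  -- middle edge `e₁` = ac is a bridge of the tree.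
  obtain ⟨e₀, e₁, e₂, h01, h12, h02, hne02⟩ :
      ∃ e₀ e₁ e₂ : S, (T.lineGraph.induce S).Adj e₀ e₁ ∧ (T.lineGraph.induce S).Adj e₁ e₂ ∧
        ¬ (T.lineGraph.induce S).Adj e₀ e₂ ∧ e₀ ≠ e₂ := by
    have h2 := hS.1.one_lt_dist_of_ne_of_not_adj hne' hnadj
    exact Walk.exists_adj_adj_not_adj_ne hq h2
  obtain ⟨-, a, ha0, ha1⟩ := id h01
  obtain ⟨-, c, hc1, hc2⟩ := id h12
  have hac : a ≠ c := by
    rintro rfl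
    exact h02 (lineGraph_adj_of_mem (fun h => hne02 (Subtype.ext h)) ha0 hc2)
  have he1 : e₁.1.1 = s(a, c) := (Sym2.mem_and_mem_iff hac).1 ⟨ha1, hc1⟩
  have hbridge : ¬ (T.deleteEdges {e₁.1.1}).Reachable a c := by
    rw [he1]
    have := isAcyclic_iff_forall_isBridge.1 hT e₁.1.2
    rw [he1] at this
    exact isBridge_iff.1 this
  have hedge : ∀ g : T.edgeSet, g ≠ e₁.1 → ∀ x y, x ∈ g.1 → y ∈ g.1 →
      (T.deleteEdges {e₁.1.1}).Reachable x y := by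
    intro g hg x y hx hy
    by_cases hxy : x = y
    · rw [hxy]
    · have hgs := (Sym2.mem_and_mem_iff hxy).1 ⟨hx, hy⟩
      refine Adj.reachable (deleteEdges_adj.2 ⟨?_, ?_⟩)
      · rw [← mem_edgeSet, ← hgs]; exact g.2
      · rw [← hgs]
        exact fun h => hg (Subtype.ext h)
  have hpre := preconnected_of_not_isCutVertex hS.1 (hS.2 e₁)
  have hreach := hpre ⟨e₀, h01.ne⟩ ⟨e₂, h12.ne'⟩
  rw [reachable_iff_reflTransGen] at hreach
  -- Since `e₁` is no cut vertex of S, a chain of edges other than `e₁` leads from `e₀` to `e₂`. It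
  -- gives a walk from a to c that avoids the bridge.
  have key : ∀ x ∈ e₂.1.1, (T.deleteEdges {e₁.1.1}).Reachable a x := by
    suffices h : ∀ g : ({e₁}ᶜ : Set S), Relation.ReflTransGen
        ((T.lineGraph.induce S).induce ({e₁}ᶜ : Set S)).Adj ⟨e₀, h01.ne⟩ g →
        ∀ x ∈ g.1.1.1, (T.deleteEdges {e₁.1.1}).Reachable a x from h _ hreach
    intro g hg
    have hgne : ∀ g : ({e₁}ᶜ : Set S), g.1.1 ≠ e₁.1 := fun g h => g.2 (Subtype.ext h)
    induction hg with
    | refl => exact fun x hx => hedge _ (hgne ⟨e₀, h01.ne⟩) a x ha0 hx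
    | @tail g g' _ hadj ih =>
      intro x hx
      obtain ⟨-, u, hu, hu'⟩ := hadj
      exact (ih u hu).trans (hedge _ (hgne g') u x hu' hx)
  exact hbridge (key c hc2)

/-- Two distinct edges of the clique meet in u; a third edge that meets both but misses u would
close a triangle in the forest. -/
theorem exists_subset_edgeStar_of_isClique (hT : T.IsAcyclic) {S : Set T.edgeSet}
    (hS : T.lineGraph.IsClique S) {e f : T.edgeSet} (he : e ∈ S) (hf : f ∈ S) (hne : e ≠ f) :
    ∃ u, u ∈ e.1 ∧ u ∈ f.1 ∧ S ⊆ edgeStar T u := by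
  obtain ⟨-, u, hue, huf⟩ := hS he hf hne
  refine ⟨u, hue, huf, fun g hg => ?_⟩
  by_contra hug
  have hge : g ≠ e := by rintro rfl; exact hug hue
  have hgf : g ≠ f := by rintro rfl; exact hug huf
  obtain ⟨-, a, hag, hae⟩ := hS hg he hge
  obtain ⟨-, c, hcg, hcf⟩ := hS hg hf hgf
  have hua : u ≠ a := by rintro rfl; exact hug hag
  have huc : u ≠ c := by rintro rfl; exact hug hcg
  have hac : a ≠ c := by
    rintro rfl
    exact hua (eq_of_mem_of_mem_edges hne hue huf hae hcf)
  have hadj : ∀ (g : T.edgeSet) (x y : U), x ≠ y → x ∈ g.1 → y ∈ g.1 → T.Adj x y := by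
    intro g x y hxy hx hy
    rw [← mem_edgeSet, ← (Sym2.mem_and_mem_iff hxy).1 ⟨hx, hy⟩]
    exact g.2
  classical
  exact hT.cliqueFree le_rfl {u, a, c} (is3Clique_triple_iff.2
    ⟨hadj e u a hua hue hae, hadj f u c huc huf hcf, hadj g a c hac hag hcg⟩)

theorem isBlock_edgeStar [Finite U] (hT : T.IsAcyclic) {u : U} {e f : T.edgeSet} (hne : e ≠ f)
    (he : e ∈ edgeStar T u) (hf : f ∈ edgeStar T u) : IsBlock T.lineGraph (edgeStar T u) := by
  rw [isBlock_iff]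
  refine ⟨isNonseparable_of_isClique (isClique_edgeStar u) ⟨e, he⟩, fun S hS hsub => ?_⟩
  obtain ⟨w, hwe, hwf, hSw⟩ := exists_subset_edgeStar_of_isClique hT
    (isClique_of_isNonseparable_lineGraph hT hS) (hsub he) (hsub hf) hne
  obtain rfl := eq_of_mem_of_mem_edges hne he hf hwe hwf
  exact hSw.antisymm hsub

theorem exists_eq_edgeStar_of_isBlock [Finite U] (hT : T.IsTree) [Nontrivial T.edgeSet]
    {B : Set T.edgeSet} (hB : IsBlock T.lineGraph B) :
    ∃ u, B = edgeStar T u ∧ ∃ e f, e ≠ f ∧ e ∈ edgeStar T u ∧ f ∈ edgeStar T u := by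
  rw [isBlock_iff] at hB
  have hclique := isClique_of_isNonseparable_lineGraph hT.isAcyclic hB.1
  obtain ⟨⟨e, he⟩⟩ := hB.1.1.nonempty
  obtain ⟨u, f, hne, hue, huf, hsub⟩ : ∃ u f, e ≠ f ∧ u ∈ e.1 ∧ u ∈ f.1 ∧ B ⊆ edgeStar T u := by
    by_cases h : ∃ f ∈ B, e ≠ f
    · obtain ⟨f, hf, hne⟩ := h
      obtain ⟨u, h1, h2, h3⟩ := exists_subset_edgeStar_of_isClique hT.isAcyclic hclique he hf hne
      exact ⟨u, f, hne, h1, h2, h3⟩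
    · push Not at h
      -- A one-element B is still contained in the star at an endpoint shared with an adjacent edge,
      -- so maximality applies to it as well.
      obtain ⟨f, hne, u, hue, huf⟩ :=
        (lineGraph_connected hT.connected ⟨e.1, e.2⟩).preconnected.exists_adj_of_nontrivial e
      refine ⟨u, f, hne, hue, huf, fun g hg => ?_⟩
      rw [← h g hg]
      exact hue
  exact ⟨u, (hB.2 _ (isNonseparable_of_isClique (isClique_edgeStar u) ⟨e, hue⟩) hsub).symm,
    e, f, hne, hue, huf⟩

theorem ncard_edgeStar (u : U) : (edgeStar T u).ncard = (T.neighborSet u).ncard := by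
  refine (Set.ncard_congr (fun x hx => (⟨s(u, x), hx⟩ : T.edgeSet)) ?_ ?_ ?_).symm
  · intro x hx
    exact Sym2.mem_mk_left _ _
  · intro x y hx hy h
    exact Sym2.congr_right.1 (congrArg Subtype.val h)
  · rintro ⟨e, he⟩ hu
    obtain ⟨x, rfl⟩ := Sym2.mem_iff_exists.1 hu
    exact ⟨x, he, rfl⟩

/-- Each leaf of a claw contains one of the two ends of the central edge, so two of the three leaves
share an end and are adjacent. -/
theorem isClawFree_lineGraph : IsClawFree T.lineGraph := by
  rintro ⟨φ⟩
  obtain ⟨⟨a, c⟩, hac⟩ : ∃ q : U × U, (φ (Sum.inl 0)).1 = s(q.1, q.2) :=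
    ⟨_, (Quot.out_eq _).symm⟩
  have hleaf : ∀ k, a ∈ (φ (Sum.inr k)).1 ∨ c ∈ (φ (Sum.inr k)).1 := by
    intro k
    have hadj : T.lineGraph.Adj (φ (Sum.inl 0)) (φ (Sum.inr k)) :=
      φ.map_adj_iff.2 (by simp [completeBipartiteGraph])
    obtain ⟨-, u, hu, hu'⟩ := hadj
    rw [hac] at hu
    rcases Sym2.mem_iff.1 hu with rfl | rfl
    · exact Or.inl hu'
    · exact Or.inr hu'
  have hno : ∀ k l : Fin 3, k ≠ l → ∀ u, u ∈ (φ (Sum.inr k)).1 → u ∉ (φ (Sum.inr l)).1 := by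
    intro k l hkl u hk hl
    have hadj := lineGraph_adj_of_mem (fun h => hkl (Sum.inr_injective (φ.injective h))) hk hl
    have := φ.map_adj_iff.1 hadj
    simp [completeBipartiteGraph] at this
  have h01 := hno 0 1 (by decide)
  have h02 := hno 0 2 (by decide)
  have h12 := hno 1 2 (by decide)
  rcases hleaf 0 with h0 | h0 <;> rcases hleaf 1 with h1 | h1 <;> rcases hleaf 2 with h2 | h2
  all_goals first
    | exact h01 _ h0 h1
    | exact h02 _ h0 h2
    | exact h12 _ h1 h2

end LineGraph

theorem IsGreedyTree.isClawFreeBlockGraph_lineGraph {t : ℕ} (ht : 1 ≤ t) {b : Fin t → ℕ}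
    (hb : Antitone b) (hb2 : ∀ i, 2 ≤ b i) {U : Type*} {T : SimpleGraph U}
    (hG : IsGreedyTree T (treeDegreeSequence b)) : IsClawFreeBlockGraph T.lineGraph b := by
  obtain ⟨hT, -, v, r, hdeg, -⟩ := hG
  have : Finite U := Finite.of_equiv _ v
  have hfin : Finite T.edgeSet := inferInstance
  have htwo : ∀ i : Fin t, ∃ e f, e ≠ f ∧ e ∈ edgeStar T (v (Fin.castAdd _ i)) ∧
      f ∈ edgeStar T (v (Fin.castAdd _ i)) := by
    intro i
    have h : 1 < (edgeStar T (v (Fin.castAdd _ i))).ncard := by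
      rw [ncard_edgeStar, hdeg, treeDegreeSequence, Fin.append_left]
      exact hb2 i
    obtain ⟨e, he, f, hf, hne⟩ := (Set.one_lt_ncard (Set.toFinite _)).1 h
    exact ⟨e, f, hne, he, hf⟩
  have hnt : Nontrivial T.edgeSet := by
    obtain ⟨e, f, hne, -⟩ := htwo ⟨0, ht⟩
    exact ⟨e, f, hne⟩
  obtain ⟨e₀⟩ := hnt.to_nonempty
  have hconn := lineGraph_connected hT.connected ⟨e₀.1, e₀.2⟩
  have hblock : ∀ i : Fin t, IsBlock T.lineGraph (edgeStar T (v (Fin.castAdd _ i))) := by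
    intro i
    obtain ⟨e, f, hne, he, hf⟩ := htwo i
    exact isBlock_edgeStar hT.isAcyclic hne he hf
  -- The blocks are the stars of the vertices of degree at least 2, which are the first t vertices
  -- in the enumeration.
  let F : Fin t → {B : Set T.edgeSet // IsBlock T.lineGraph B} := fun i => ⟨_, hblock i⟩
  have hF : Function.Bijective F := by
    constructor
    · intro i j hij
      have hij' : edgeStar T (v (Fin.castAdd _ i)) = edgeStar T (v (Fin.castAdd _ j)) :=
        congrArg Subtype.val hij
      obtain ⟨e, f, hne, he, hf⟩ := htwo i
      have he' := he
      have hf' := hf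
      rw [hij'] at he' hf'
      exact Fin.castAdd_injective _ _ (v.injective (eq_of_mem_of_mem_edges hne he hf he' hf'))
    · rintro ⟨B, hB⟩
      obtain ⟨u, rfl, e, f, hne, he, hf⟩ := exists_eq_edgeStar_of_isBlock hT hB
      obtain ⟨j, rfl⟩ := v.surjective u
      induction j using Fin.addCases with
      | left i => exact ⟨i, rfl⟩
      | right i =>
        have h : 1 < (edgeStar T (v (Fin.natAdd _ i))).ncard :=
          (Set.one_lt_ncard (Set.toFinite _)).2 ⟨e, he, f, hf, hne⟩
        rw [ncard_edgeStar, hdeg, treeDegreeSequence, Fin.append_right] at h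
        exact absurd h (lt_irrefl _)
  refine ⟨hfin, hconn, fun B hB => ?_, isClawFree_lineGraph, hb, Equiv.ofBijective F hF, ?_⟩
  · exact isClique_of_isNonseparable_lineGraph hT.isAcyclic hB.1
  · intro i
    change (edgeStar T (v (Fin.castAdd _ i))).ncard = b i
    rw [ncard_edgeStar, hdeg, treeDegreeSequence, Fin.append_left]

/-! ### Walks avoiding a vertex -/

section Avoid

variable {V : Type*} {G : SimpleGraph V} {x u w z : V}

/-- Some walk from `u` to `w` avoids `x`. -/
def JoinedAvoiding (G : SimpleGraph V) (x u w : V) : Prop := ∃ q : G.Walk u w, x ∉ q.support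

theorem JoinedAvoiding.refl (h : u ≠ x) : JoinedAvoiding G x u u :=
  ⟨Walk.nil, by simpa using h.symm⟩

theorem JoinedAvoiding.symm (h : JoinedAvoiding G x u w) : JoinedAvoiding G x w u := by
  obtain ⟨q, hq⟩ := h
  exact ⟨q.reverse, by simpa using hq⟩

theorem JoinedAvoiding.trans (h : JoinedAvoiding G x u w) (h' : JoinedAvoiding G x w z) :
    JoinedAvoiding G x u z := by
  obtain ⟨q, hq⟩ := h
  obtain ⟨q', hq'⟩ := h'
  exact ⟨q.append q', by simp [Walk.mem_support_append_iff, hq, hq']⟩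

theorem JoinedAvoiding.of_adj (h : G.Adj u w) (hu : u ≠ x) (hw : w ≠ x) :
    JoinedAvoiding G x u w :=
  ⟨h.toWalk, by simp [hu.symm, hw.symm]⟩

theorem JoinedAvoiding.ne_right (h : JoinedAvoiding G x u w) : w ≠ x := by
  obtain ⟨q, hq⟩ := h
  rintro rfl
  exact hq q.end_mem_support

theorem JoinedAvoiding.ne_left (h : JoinedAvoiding G x u w) : u ≠ x := h.symm.ne_right

theorem JoinedAvoiding.of_isClique {B : Set V} (hB : G.IsClique B) (hu : u ∈ B) (hw : w ∈ B)
    (hux : u ≠ x) (hwx : w ≠ x) : JoinedAvoiding G x u w := by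
  by_cases h : u = w
  · rw [← h]; exact .refl hux
  · exact .of_adj (hB hu hw h) hux hwx

end Avoid

/-! ### Blocks of claw-free block graphs -/

section Block

variable {V : Type*} {G : SimpleGraph V}

theorem isNonseparable_of_walks {S : Set V} (y : V) (hy : y ∈ S)
    (hconn : ∀ u ∈ S, ∃ q : G.Walk u y, ∀ x ∈ q.support, x ∈ S)
    (hcut : ∀ z ∈ S, ∀ u ∈ S, ∀ w ∈ S, u ≠ z → w ≠ z →
      ∃ q : G.Walk u w, ∀ x ∈ q.support, x ∈ S ∧ x ≠ z) : IsNonseparable G S := by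
  have hc : (G.induce S).Connected := by
    refine (connected_iff _).2 ⟨?_, ⟨⟨y, hy⟩⟩⟩
    have : ∀ u : S, (G.induce S).Reachable u ⟨y, hy⟩ := by
      intro u
      obtain ⟨q, hq⟩ := hconn u u.2
      exact ⟨q.induce S hq⟩
    exact fun u w => (this u).trans (this w).symm
  refine ⟨hc, fun z => not_isCutVertex_of_preconnected hc ?_⟩
  rintro ⟨⟨u, hu⟩, huz⟩ ⟨⟨w, hw⟩, hwz⟩
  obtain ⟨q, hq⟩ := hcut z z.2 u hu w hw (fun h => huz (Subtype.ext h))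
    (fun h => hwz (Subtype.ext h))
  refine ⟨(q.induce S fun x hx => (hq x hx).1).induce _ fun x hx => ?_⟩
  rw [Walk.support_induce] at hx
  simp only [List.mem_attachWith] at hx
  exact fun h => (hq x hx).2 (congrArg Subtype.val h)

/-- In a block graph, neighbours of `y` that are joined by a walk avoiding `y` are adjacent,
because they lie on a cycle through `y`. -/
theorem eq_or_adj_of_joinedAvoiding [Finite V] (hG : IsBlockGraph G) {y a c : V}
    (ha : G.Adj y a) (hc : G.Adj y c) (h : JoinedAvoiding G y a c) : a = c ∨ G.Adj a c := by
  classical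
  obtain ⟨q, hq⟩ := h
  obtain ⟨p, hp, hyp⟩ : ∃ p : G.Walk a c, p.IsPath ∧ y ∉ p.support :=
    ⟨q.bypass, q.bypass_isPath, fun h => hq (q.support_bypass_subset_support h)⟩
  set S : Set V := insert y {x | x ∈ p.support} with hS
  have hsub : ∀ x ∈ p.support, x ∈ S := fun x hx => Set.mem_insert_of_mem _ hx
  -- When z ≠ y is deleted from the cycle formed by p and y, each remaining vertex still reaches y
  -- along the side of the cycle that misses z.
  have htoY : ∀ z ∈ p.support, ∀ u ∈ S, u ≠ z →
      ∃ q : G.Walk u y, ∀ x ∈ q.support, x ∈ S ∧ x ≠ z := by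
    intro z hz u hu huz
    have hyz : y ≠ z := by rintro rfl; exact hyp hz
    rcases hu with rfl | hu
    · exact ⟨Walk.nil, by simpa [hS] using hyz⟩
    have hu : u ∈ p.support := hu
    by_cases hzt : z ∈ (p.takeUntil u hu).support
    · have hzd : z ∉ (p.dropUntil u hu).support := by
        intro hzd
        have hpath := hp
        rw [← p.take_spec hu] at hpath
        exact hpath.ne_of_mem_support_of_append huz.symm hzt hzd rfl
      refine ⟨(p.dropUntil u hu).concat hc.symm, fun x hx => ?_⟩
      simp only [Walk.support_concat, List.mem_append, List.mem_singleton] at hx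
      rcases hx with hx | rfl
      · exact ⟨hsub x (p.support_dropUntil_subset_support hu hx), fun h => hzd (h ▸ hx)⟩
      · exact ⟨Set.mem_insert _ _, hyz⟩
    · refine ⟨(p.takeUntil u hu).reverse.concat ha.symm, fun x hx => ?_⟩
      simp only [Walk.support_concat, List.mem_append, List.mem_singleton] at hx
      rcases hx with hx | rfl
      · rw [Walk.support_reverse, List.mem_reverse] at hx
        exact ⟨hsub x (p.support_takeUntil_subset_support hu hx), fun h => hzt (h ▸ hx)⟩
      · exact ⟨Set.mem_insert _ _, hyz⟩
  have htoA : ∀ u ∈ p.support, ∃ q : G.Walk u a, ∀ x ∈ q.support, x ∈ p.support :=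
    fun u hu => ⟨(p.takeUntil u hu).reverse, fun x hx => by
      rw [Walk.support_reverse, List.mem_reverse] at hx
      exact p.support_takeUntil_subset_support hu hx⟩
  have hns : IsNonseparable G S := by
    refine isNonseparable_of_walks y (Set.mem_insert _ _) ?_ ?_
    · rintro u (rfl | hu)
      · exact ⟨Walk.nil, by simp [hS]⟩
      · obtain ⟨q, hq⟩ := htoA u hu
        refine ⟨q.concat ha.symm, fun x hx => ?_⟩
        simp only [Walk.support_concat, List.mem_append, List.mem_singleton] at hx
        rcases hx with hx | rfl
        · exact hsub x (hq x hx)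
        · exact Set.mem_insert _ _
    · rintro z (rfl | hz) u hu w hw huz hwz
      · obtain ⟨q, hq⟩ := htoA u (hu.resolve_left huz)
        obtain ⟨q', hq'⟩ := htoA w (hw.resolve_left hwz)
        refine ⟨q.append q'.reverse, fun x hx => ?_⟩
        rw [Walk.mem_support_append_iff, Walk.support_reverse, List.mem_reverse] at hx
        have hx' : x ∈ p.support := hx.elim (hq x) (hq' x)
        exact ⟨hsub x hx', by rintro rfl; exact hyp hx'⟩
      · obtain ⟨q, hq⟩ := htoY z hz u hu huz
        obtain ⟨q', hq'⟩ := htoY z hz w hw hwz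
        refine ⟨q.append q'.reverse, fun x hx => ?_⟩
        rw [Walk.mem_support_append_iff, Walk.support_reverse, List.mem_reverse] at hx
        exact hx.elim (hq x) (hq' x)
  obtain ⟨B, hSB, hB⟩ := hns.exists_isBlock_superset
  by_cases hac : a = c
  · exact Or.inl hac
  · exact Or.inr (hG B hB (hSB (hsub a p.start_mem_support)) (hSB (hsub c p.end_mem_support)) hac)

theorem IsBlock.nonempty {B : Set V} (hB : IsBlock G B) : B.Nonempty := by
  obtain ⟨⟨x, hx⟩⟩ := hB.1.1.nonempty
  exact ⟨x, hx⟩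

theorem exists_isBlock_of_mem [Finite V] (x : V) : ∃ B, IsBlock G B ∧ x ∈ B := by
  obtain ⟨B, hB, hB'⟩ := (isNonseparable_of_isClique (G := G) (S := {x})
    (Set.pairwise_singleton _ _) ⟨x, rfl⟩).exists_isBlock_superset
  exact ⟨B, hB', hB rfl⟩

theorem exists_isBlock_of_adj [Finite V] {a c : V} (h : G.Adj a c) :
    ∃ B, IsBlock G B ∧ a ∈ B ∧ c ∈ B := by
  obtain ⟨B, hB, hB'⟩ := (isNonseparable_of_isClique (G := G) (S := {a, c})
    (isClique_pair.2 fun _ => h)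
    ⟨a, by simp⟩).exists_isBlock_superset
  exact ⟨B, hB', hB (by simp), hB (by simp)⟩

/-- Vertices other than x of the two blocks are neighbours of x joined around x, hence equal or
adjacent. So the union of the blocks is a clique, and maximality makes it equal to both. -/
theorem IsBlock.eq_of_joinedAvoiding [Finite V] (hG : IsBlockGraph G) {B B' : Set V}
    (hB : IsBlock G B) (hB' : IsBlock G B') {x z z' : V} (hx : x ∈ B) (hx' : x ∈ B')
    (hz : z ∈ B) (hz' : z' ∈ B') (h : JoinedAvoiding G x z z') : B = B' := by
  have hc := hG B hB
  have hc' := hG B' hB'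
  have hcross : ∀ u ∈ B, ∀ w ∈ B', u ≠ w → G.Adj u w := by
    intro u hu w hw huw
    by_cases hux : u = x
    · subst hux; exact hc' hx' hw huw
    by_cases hwx : w = x
    · subst hwx; exact hc hu hx huw
    have hj : JoinedAvoiding G x u w :=
      ((JoinedAvoiding.of_isClique hc hu hz hux h.ne_left).trans h).trans
        (JoinedAvoiding.of_isClique hc' hz' hw h.ne_right hwx)
    exact (eq_or_adj_of_joinedAvoiding hG (hc hx hu (Ne.symm hux)) (hc' hx' hw (Ne.symm hwx))
      hj).resolve_left huw
  have hclique : G.IsClique (B ∪ B') := by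
    rintro u (hu | hu) w (hw | hw) huw
    · exact hc hu hw huw
    · exact hcross u hu w hw huw
    · exact (hcross w hw u hu huw.symm).symm
    · exact hc' hu hw huw
  have hns := isNonseparable_of_isClique hclique ⟨x, Or.inl hx⟩
  exact ((isBlock_iff.1 hB).2 _ hns Set.subset_union_left).symm.trans
    ((isBlock_iff.1 hB').2 _ hns Set.subset_union_right)

theorem IsBlock.eq_of_mem_of_mem [Finite V] (hG : IsBlockGraph G) {B B' : Set V}
    (hB : IsBlock G B) (hB' : IsBlock G B') {x z : V} (hxz : z ≠ x) (hx : x ∈ B) (hx' : x ∈ B')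
    (hz : z ∈ B) (hz' : z ∈ B') : B = B' :=
  hB.eq_of_joinedAvoiding hG hB' hx hx' hz hz' (.refl hxz)

/-- In a claw-free block graph no vertex lies in three blocks. -/
theorem eq_of_mem_three_isBlock [Finite V] (hG : IsBlockGraph G) (hclaw : IsClawFree G)
    (hsize : ∀ B, IsBlock G B → 2 ≤ B.ncard) {x : V} (B : Fin 3 → Set V)
    (hB : ∀ k, IsBlock G (B k)) (hx : ∀ k, x ∈ B k) : ¬ Function.Injective B := by
  intro hinj
  have hex : ∀ k, ∃ z ∈ B k, z ≠ x := fun k => by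
    have h : 1 < (B k).ncard := hsize _ (hB k)
    exact Set.exists_ne_of_one_lt_ncard h x
  choose z hz hzx using hex
  have hnj : ∀ k l, k ≠ l → ¬ JoinedAvoiding G x (z k) (z l) := fun k l hkl h =>
    hkl (hinj ((hB k).eq_of_joinedAvoiding hG (hB l) (hx k) (hx l) (hz k) (hz l) h))
  have hadj : ∀ k, G.Adj x (z k) := fun k => hG _ (hB k) (hx k) (hz k) (hzx k).symm
  have hzinj : Function.Injective z := by
    intro k l hkl
    by_contra h
    refine hnj k l h ?_
    rw [hkl]
    exact .refl (hzx l)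
  have hzadj : ∀ k l, ¬ G.Adj (z k) (z l) := by
    intro k l h
    have hkl : k ≠ l := by rintro rfl; exact h.ne rfl
    exact hnj k l hkl (.of_adj h (hzx k) (hzx l))
  -- x with one further vertex from each of the three blocks would be an induced claw.
  refine hclaw ⟨⟨⟨Sum.elim (fun _ => x) z, ?_⟩, ?_⟩⟩
  · rintro (i | k) (j | l) h
    · rw [Subsingleton.elim i j]
    · exact absurd h (hzx l).symm
    · exact absurd h (hzx k)
    · exact congrArg Sum.inr (hzinj h)
  · rintro (i | k) (j | l)
    · exact iff_of_false (fun h => h.ne rfl) (by simp)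
    · exact iff_of_true (hadj l) (by simp)
    · exact iff_of_true (hadj k).symm (by simp)
    · exact iff_of_false (hzadj k l) (by simp)

theorem eq_or_eq_of_mem_isBlock [Finite V] (hG : IsBlockGraph G) (hclaw : IsClawFree G)
    (hsize : ∀ B, IsBlock G B → 2 ≤ B.ncard) {x : V} {B₁ B₂ B₃ : Set V}
    (h₁ : IsBlock G B₁) (h₂ : IsBlock G B₂) (h₃ : IsBlock G B₃) (hx₁ : x ∈ B₁) (hx₂ : x ∈ B₂)
    (hx₃ : x ∈ B₃) (h12 : B₁ ≠ B₂) : B₃ = B₁ ∨ B₃ = B₂ := by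
  by_contra h
  push Not at h
  refine eq_of_mem_three_isBlock hG hclaw hsize (x := x) ![B₁, B₂, B₃] ?_ ?_ ?_
  · intro k; fin_cases k <;> assumption
  · intro k; fin_cases k <;> assumption
  · intro k l hkl
    fin_cases k <;> fin_cases l <;> simp_all [eq_comm]

end Block

/-! ### Block graphs rooted at a block -/

section RootedBlock

variable {V : Type*} {G : SimpleGraph V} {B₀ : Set V}

/-- The distance of `u` from the root block `B₀`. -/
noncomputable def depth (G : SimpleGraph V) (B₀ : Set V) (u : V) : ℕ :=
  sInf ((fun b => G.dist u b) '' B₀)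

theorem depth_le {u b : V} (hb : b ∈ B₀) : depth G B₀ u ≤ G.dist u b :=
  Nat.sInf_le ⟨b, hb, rfl⟩

theorem exists_depth_eq (hne : B₀.Nonempty) (u : V) : ∃ b ∈ B₀, depth G B₀ u = G.dist u b := by
  obtain ⟨b, hb, h⟩ := Nat.sInf_mem (hne.image fun b => G.dist u b)
  exact ⟨b, hb, h.symm⟩

theorem depth_eq_zero {u : V} (hu : u ∈ B₀) : depth G B₀ u = 0 :=
  Nat.le_zero.1 ((depth_le hu).trans_eq SimpleGraph.dist_self)

theorem depth_le_depth_add_dist (hconn : G.Connected) (hne : B₀.Nonempty) (u w : V) :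
    depth G B₀ u ≤ depth G B₀ w + G.dist u w := by
  obtain ⟨b, hb, h⟩ := exists_depth_eq (G := G) hne w
  have h1 : G.dist u b ≤ G.dist u w + G.dist w b := hconn.dist_triangle
  have h2 := depth_le (G := G) (u := u) hb
  omega

theorem depth_le_of_adj (hconn : G.Connected) (hne : B₀.Nonempty) {u w : V} (h : G.Adj u w) :
    depth G B₀ u ≤ depth G B₀ w + 1 := by
  have := depth_le_depth_add_dist hconn hne u w
  rwa [dist_eq_one_iff_adj.2 h] at this

theorem exists_adj_depth_eq_add_one (hconn : G.Connected) (hne : B₀.Nonempty) {u : V}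
    (hu : u ∉ B₀) : ∃ u', G.Adj u u' ∧ depth G B₀ u = depth G B₀ u' + 1 := by
  obtain ⟨b, hb, h⟩ := exists_depth_eq (G := G) hne u
  have hub : u ≠ b := by rintro rfl; exact hu hb
  obtain ⟨a, ha, hd⟩ := exists_adj_dist_eq_add_one hconn hub
  refine ⟨a, ha.symm, le_antisymm (depth_le_of_adj hconn hne ha.symm) ?_⟩
  have := depth_le (G := G) (u := a) hb
  rw [dist_comm] at this
  rw [dist_comm] at h
  omega

/-- The set of the vertices that `x` separates from the root block. -/
def behind (G : SimpleGraph V) (B₀ : Set V) (x : V) : Set V :=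
  {u | u ≠ x ∧ ∀ b ∈ B₀, ¬ JoinedAvoiding G x u b}

/-- A descent from u towards the root block cannot meet x: all vertices after u have depth smaller
than that of x. -/
theorem exists_joinedAvoiding_of_depth_le (hconn : G.Connected) (hne : B₀.Nonempty) {x u : V}
    (hxu : u ≠ x) (hd : depth G B₀ u ≤ depth G B₀ x) : ∃ b ∈ B₀, JoinedAvoiding G x u b := by
  induction hm : depth G B₀ u using Nat.strong_induction_on generalizing u with
  | _ m ih =>
    by_cases hu : u ∈ B₀
    · exact ⟨u, hu, .refl hxu⟩
    · obtain ⟨u', hadj, hd'⟩ := exists_adj_depth_eq_add_one hconn hne hu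
      have hne' : u' ≠ x := by rintro rfl; omega
      obtain ⟨b, hb, h⟩ := ih _ (by omega) hne' (by omega) rfl
      exact ⟨b, hb, (JoinedAvoiding.of_adj hadj hxu hne').trans h⟩

theorem depth_lt_of_mem_behind (hconn : G.Connected) (hne : B₀.Nonempty) {x u : V}
    (h : u ∈ behind G B₀ x) : depth G B₀ x < depth G B₀ u := by
  by_contra hd
  obtain ⟨b, hb, hj⟩ := exists_joinedAvoiding_of_depth_le hconn hne h.1 (not_lt.1 hd)
  exact h.2 b hb hj

theorem notMem_of_mem_behind {x u : V} (h : u ∈ behind G B₀ x) : u ∉ B₀ :=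
  fun hu => h.2 u hu (.refl h.1)

theorem behind_of_joinedAvoiding {x u w : V} (h : u ∈ behind G B₀ x)
    (hj : JoinedAvoiding G x u w) : w ∈ behind G B₀ x :=
  ⟨hj.ne_right, fun b hb hw => h.2 b hb (hj.trans hw)⟩

theorem behind_subset (hconn : G.Connected) (hne : B₀.Nonempty) {x u : V}
    (h : u ∈ behind G B₀ x) : behind G B₀ u ⊆ behind G B₀ x := by
  classical
  intro w hw
  have hwx : w ≠ x := by
    rintro rfl
    have h1 := depth_lt_of_mem_behind hconn hne h
    have h2 := depth_lt_of_mem_behind hconn hne hw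
    omega
  refine ⟨hwx, fun b hb ⟨q, hq⟩ => ?_⟩
  by_cases huq : u ∈ q.support
  · exact h.2 b hb ⟨q.dropUntil u huq, fun hx => hq (q.support_dropUntil_subset_support huq hx)⟩
  · exact hw.2 b hb ⟨q, huq⟩

theorem mem_support_of_separates {x u w : V} (hu : u ∈ behind G B₀ x) (hw : w ∉ behind G B₀ x)
    (q : G.Walk u w) : x ∈ q.support := by
  by_contra hq
  exact hw (behind_of_joinedAvoiding hu ⟨q, hq⟩)

open Finset in
-- Each counted x lies on every walk from u to w, and a shortest walk has d(u,w) + 1 vertices, two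
-- of which are u and w.
theorem one_add_card_le_dist [Fintype V] [DecidableEq V] (hconn : G.Connected)
    (K : V → Finset V) (hK : ∀ x u, u ∈ K x ↔ u ∈ behind G B₀ x) {u w : V} (huw : u ≠ w) :
    1 + #{x | x ≠ u ∧ x ≠ w ∧ ¬ (u ∈ K x ↔ w ∈ K x)} ≤ G.dist u w := by
  obtain ⟨q, hq⟩ := hconn.exists_walk_length_eq_dist u w
  have hsub : insert u (insert w (univ.filter fun x =>
      x ≠ u ∧ x ≠ w ∧ ¬ (u ∈ K x ↔ w ∈ K x))) ⊆ q.support.toFinset := by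
    intro x hx
    rw [List.mem_toFinset]
    simp only [mem_insert, mem_filter, mem_univ, true_and, hK] at hx
    rcases hx with rfl | rfl | ⟨-, -, hx⟩
    · exact q.start_mem_support
    · exact q.end_mem_support
    · by_cases h : u ∈ behind G B₀ x
      · exact mem_support_of_separates h (fun h' => hx (iff_of_true h h')) q
      · have h' : w ∈ behind G B₀ x := by tauto
        simpa using mem_support_of_separates h' h q.reverse
  have h1 := card_le_card hsub
  rw [card_insert_of_notMem (by simp [huw]), card_insert_of_notMem (by simp)] at h1
  have h2 := h1.trans (List.toFinset_card_le _)
  rw [Walk.length_support] at h2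
  omega

/-- `x` is `u` or separates `u` from the root block. -/
def IsAbove (G : SimpleGraph V) (B₀ : Set V) (x u : V) : Prop := x = u ∨ u ∈ behind G B₀ x

variable [Finite V]

/-- A detour around u' would put u in the root block if u' lies there, and otherwise would make u
equal or adjacent to the parent of u', whose depth is smaller by two. -/
theorem mem_behind_parent (hconn : G.Connected) (hG : IsBlockGraph G) (hB : IsBlock G B₀)
    {u u' : V} (hu : u ∉ B₀) (hadj : G.Adj u u') (hd : depth G B₀ u = depth G B₀ u' + 1) :
    u ∈ behind G B₀ u' := by
  have hne := hB.nonempty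
  refine ⟨hadj.ne, fun b hb hj => ?_⟩
  by_cases hu' : u' ∈ B₀
  · obtain ⟨B, hB', huB, hu'B⟩ := exists_isBlock_of_adj hadj
    exact hu (hB'.eq_of_joinedAvoiding hG hB hu'B hu' huB hb hj ▸ huB)
  · obtain ⟨u'', hadj', hd'⟩ := exists_adj_depth_eq_add_one hconn hne hu'
    obtain ⟨b', hb', hj'⟩ :=
      exists_joinedAvoiding_of_depth_le hconn hne hadj'.ne' (by omega : depth G B₀ u'' ≤ _)
    have hj'' : JoinedAvoiding G u' u u'' :=
      (hj.trans (.of_isClique (hG _ hB) hb hb' hj.ne_right hj'.ne_right)).trans hj'.symm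
    rcases eq_or_adj_of_joinedAvoiding hG hadj.symm hadj' hj'' with rfl | h
    · omega
    · have := depth_le_of_adj hconn hne h
      omega

theorem IsAbove.of_parent (hconn : G.Connected) (hG : IsBlockGraph G) (hB : IsBlock G B₀)
    {x u u' : V} (hu : u ∉ B₀) (hadj : G.Adj u u') (hd : depth G B₀ u = depth G B₀ u' + 1)
    (h : IsAbove G B₀ x u') : IsAbove G B₀ x u ∧ x ≠ u := by
  have hne := hB.nonempty
  rcases h with rfl | h
  · exact ⟨Or.inr (mem_behind_parent hconn hG hB hu hadj hd), hadj.ne'⟩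
  · have h1 := depth_lt_of_mem_behind hconn hne h
    have hxu : u ≠ x := by rintro rfl; omega
    exact ⟨Or.inr (behind_of_joinedAvoiding h (.of_adj hadj.symm h.1 hxu)), hxu.symm⟩

end RootedBlock

/-! ### Claw-free block graphs: lower bound for the Wiener index -/

section Class

open Finset

variable {V : Type*} [Fintype V] {G : SimpleGraph V} {t : ℕ} {b : Fin t → ℕ}

theorem IsClawFreeBlockGraph.exists_blocks (h : IsClawFreeBlockGraph G b) :
    ∃ β : Fin t → Finset V, Function.Injective β ∧
      (∀ B : Set V, IsBlock G B ↔ ∃ i, B = β i) ∧ ∀ i, #(β i) = b i := by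
  classical
  obtain ⟨-, B, hB⟩ := h.blockOrder
  refine ⟨fun i => (B i).1.toFinset, fun i j hij => ?_, fun S => ⟨fun hS => ?_, ?_⟩, fun i => ?_⟩
  · exact B.injective (Subtype.ext (Set.toFinset_inj.1 hij))
  · exact ⟨B.symm ⟨S, hS⟩, by simp⟩
  · rintro ⟨i, rfl⟩
    simpa using (B i).2
  · rw [← hB i, Set.ncard_eq_toFinset_card']

theorem IsClawFreeBlockGraph.two_le_ncard (h : IsClawFreeBlockGraph G b) (hb2 : ∀ i, 2 ≤ b i)
    (B : Set V) (hB : IsBlock G B) : 2 ≤ B.ncard := by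
  obtain ⟨β, -, hβ, hcard⟩ := h.exists_blocks
  obtain ⟨i, rfl⟩ := (hβ B).1 hB
  rw [Set.ncard_coe_finset, hcard]
  exact hb2 i

/-- A set that contains with every vertex outside the root block a neighbour closer to the root
block has at most `growth b` neighbours, because it meets few blocks. -/
theorem IsClawFreeBlockGraph.card_le_growth (h : IsClawFreeBlockGraph G b) (hb : Antitone b)
    (hb2 : ∀ i, 2 ≤ b i) {B₀ : Set V} (hB₀ : IsBlock G B₀) (W A : Finset V)
    (hW : ∀ u ∈ W, u ∉ B₀ → ∃ u' ∈ W, G.Adj u u' ∧ depth G B₀ u' < depth G B₀ u)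
    (hA : ∀ u ∈ A, u ∈ B₀ ∨ u ∈ W ∨ ∃ w ∈ W, G.Adj u w) : #A ≤ growth b #W := by
  classical
  obtain ⟨β, hinj, hβ, hcard⟩ := h.exists_blocks
  have hsize := h.two_le_ncard hb2
  have hblk : ∀ i, IsBlock G (β i : Set V) := fun i => (hβ _).2 ⟨i, rfl⟩
  obtain ⟨i₀, hi₀⟩ := (hβ B₀).1 hB₀
  -- Vertices are added in order of depth. Each lies in a block already collected, namely `B₀` or
  -- one shared with its neighbour nearer to the root, and by claw-freeness in at most one other.
  have key : ∀ W : Finset V,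
      (∀ u ∈ W, u ∉ B₀ → ∃ u' ∈ W, G.Adj u u' ∧ depth G B₀ u' < depth G B₀ u) →
      ∃ Q : Finset (Fin t), i₀ ∈ Q ∧ (∀ i, ∀ w ∈ W, w ∈ β i → i ∈ Q) ∧ #Q ≤ #W + 1 ∧
        #(Q.biUnion β) ≤ 1 + ∑ i ∈ Q, (b i - 1) := by
    intro W
    induction W using Finset.induction_on_max_value (depth G B₀) with
    | empty =>
      intro _
      refine ⟨{i₀}, mem_singleton_self _, by simp, by simp, ?_⟩
      have := hb2 i₀
      rw [singleton_biUnion, hcard, sum_singleton]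
      omega
    | insert a s ha hmax ih =>
      intro hW
      obtain ⟨Q, hQ₀, hQ, hQc, hQu⟩ := ih fun u hu huB => by
        obtain ⟨u', hu', hadj, hd⟩ := hW u (mem_insert_of_mem hu) huB
        rcases mem_insert.1 hu' with rfl | hu'
        · exact absurd hd (not_lt.2 (hmax u hu))
        · exact ⟨u', hu', hadj, hd⟩
      obtain ⟨j, hjQ, haj⟩ : ∃ j ∈ Q, a ∈ β j := by
        by_cases haB : a ∈ B₀
        · exact ⟨i₀, hQ₀, by rw [hi₀] at haB; exact haB⟩
        · obtain ⟨u', hu', hadj, -⟩ := hW a (mem_insert_self _ _) haB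
          have hu's : u' ∈ s := (mem_insert.1 hu').resolve_left hadj.ne'
          obtain ⟨B, hB, haB', hu'B⟩ := exists_isBlock_of_adj hadj
          obtain ⟨j, rfl⟩ := (hβ B).1 hB
          exact ⟨j, hQ j u' hu's hu'B, haB'⟩
      rw [card_insert_of_notMem ha]
      by_cases hall : ∀ i, a ∈ β i → i ∈ Q
      · refine ⟨Q, hQ₀, fun i w hw hwi => ?_, by omega, hQu⟩
        rcases mem_insert.1 hw with rfl | hw
        · exact hall i hwi
        · exact hQ i w hw hwi
      · push Not at hall
        obtain ⟨i, hai, hiQ⟩ := hall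
        refine ⟨insert i Q, mem_insert_of_mem hQ₀, fun k w hw hwk => ?_, ?_, ?_⟩
        · rcases mem_insert.1 hw with rfl | hw
          · have hij : (β i : Set V) ≠ β j := by
              intro hij
              exact hiQ (hinj (coe_injective hij) ▸ hjQ)
            rcases eq_or_eq_of_mem_isBlock h.blockGraph h.clawFree hsize (hblk i) (hblk j)
              (hblk k) hai haj hwk hij with hk | hk
            · rw [hinj (coe_injective hk)]; exact mem_insert_self _ _
            · rw [hinj (coe_injective hk)]; exact mem_insert_of_mem hjQ
          · exact mem_insert_of_mem (hQ k w hw hwk)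
        · rw [card_insert_of_notMem hiQ]; omega
        · rw [biUnion_insert, sum_insert hiQ]
          -- The new block meets the old union in a, so it contributes at most `b i - 1` vertices.
          have h1 := card_union_add_card_inter (β i) (Q.biUnion β)
          have h2 : 0 < #(β i ∩ Q.biUnion β) :=
            card_pos.2 ⟨a, mem_inter.2 ⟨hai, mem_biUnion.2 ⟨j, hjQ, haj⟩⟩⟩
          rw [hcard] at h1
          omega
  obtain ⟨Q, hQ₀, hQ, hQc, hQu⟩ := key W hW
  have hAQ : A ⊆ Q.biUnion β := by
    intro u hu
    rw [mem_biUnion]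
    rcases hA u hu with hu | hu | ⟨w, hw, hadj⟩
    · exact ⟨i₀, hQ₀, by rw [hi₀] at hu; exact hu⟩
    · obtain ⟨B, hB, huB⟩ := exists_isBlock_of_mem (G := G) u
      obtain ⟨j, rfl⟩ := (hβ B).1 hB
      exact ⟨j, hQ j u hu huB, huB⟩
    · obtain ⟨B, hB, huB, hwB⟩ := exists_isBlock_of_adj hadj
      obtain ⟨j, rfl⟩ := (hβ B).1 hB
      exact ⟨j, hQ j w hw hwB, huB⟩
  refine ((card_le_card hAQ).trans hQu).trans (Nat.add_le_add_left ?_ 1)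
  have h1 : ∑ i ∈ Q, (b i - 1) = ∑ i ∈ Q.map Fin.valEmbedding, excess b i := by
    rw [sum_map]
    exact sum_congr rfl fun i _ => by simp [excess]
  rw [h1]
  exact sum_le_sum_range_of_antitone _ (excess_antitone hb) _ _ (by rwa [card_map])

/-- Every vertex outside the root block is charged to the block that it shares with its parent. A
block other than the root block receives all its vertices except the one nearest to the root block.
-/
theorem IsClawFreeBlockGraph.blockGraphOrder_le_card (h : IsClawFreeBlockGraph G b)
    (hb2 : ∀ i, 2 ≤ b i) {B₀ : Set V} (hB₀ : IsBlock G B₀) :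
    blockGraphOrder b ≤ Fintype.card V := by
  classical
  obtain ⟨β, hinj, hβ, hcard⟩ := h.exists_blocks
  have hG := h.blockGraph
  have hconn := h.connected
  have hne := hB₀.nonempty
  have hblk : ∀ i, IsBlock G (β i : Set V) := fun i => (hβ _).2 ⟨i, rfl⟩
  obtain ⟨i₀, hi₀⟩ := (hβ B₀).1 hB₀
  have hpar : ∀ u, ∃ u', u ∉ B₀ → G.Adj u u' ∧ depth G B₀ u = depth G B₀ u' + 1 := by
    intro u
    by_cases hu : u ∈ B₀
    · exact ⟨u, fun h => absurd hu h⟩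
    · obtain ⟨u', hu'⟩ := exists_adj_depth_eq_add_one hconn hne hu
      exact ⟨u', fun _ => hu'⟩
  choose π hπ using hpar
  have huniq : ∀ i j x z, z ≠ x → x ∈ β i → x ∈ β j → z ∈ β i → z ∈ β j → i = j :=
    fun i j x z hzx h1 h2 h3 h4 =>
      hinj (coe_injective ((hblk i).eq_of_mem_of_mem hG (hblk j) hzx h1 h2 h3 h4))
  let fib : Fin t → Finset V := fun i => {u | u ∉ B₀ ∧ u ∈ β i ∧ π u ∈ β i}
  have hfib : ∀ i, i ≠ i₀ → b i - 1 ≤ #(fib i) := by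
    intro i hi
    have hbi : (β i).Nonempty := card_pos.1 (by have := hb2 i; rw [hcard]; omega)
    obtain ⟨x, hx, hmin⟩ := exists_min_image (β i) (depth G B₀) hbi
    rw [← hcard, ← card_erase_of_mem hx]
    refine card_le_card fun u hu => ?_
    obtain ⟨hux, hu⟩ := mem_erase.1 hu
    have huB : u ∉ B₀ := by
      intro huB
      have h1 := hmin u hu
      rw [depth_eq_zero huB] at h1
      have hxB : x ∈ B₀ := by
        by_contra hxB
        obtain ⟨x', -, hx'⟩ := exists_adj_depth_eq_add_one hconn hne hxB
        omega
      rw [hi₀] at huB hxB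
      exact hi (huniq i i₀ x u hux hx hxB hu huB)
    obtain ⟨hadj, hd⟩ := hπ u huB
    refine mem_filter.2 ⟨mem_univ _, huB, hu, ?_⟩
    by_cases hπx : π u = x
    · rw [hπx]; exact hx
    have hxu : G.Adj x u := hG _ (hblk i) hx hu hux.symm
    obtain ⟨c, hc, hj⟩ := exists_joinedAvoiding_of_depth_le hconn hne hux.symm (hmin u hu)
    obtain ⟨c', hc', hj'⟩ := exists_joinedAvoiding_of_depth_le hconn hne hadj.ne'
      (by omega : depth G B₀ (π u) ≤ _)
    have hjoin : JoinedAvoiding G u x (π u) :=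
      (hj.trans (.of_isClique (hG _ hB₀) hc hc' hj.ne_right hj'.ne_right)).trans hj'.symm
    obtain ⟨B, hB, huB', hπB⟩ := exists_isBlock_of_adj hadj
    have := (hblk i).eq_of_joinedAvoiding hG hB hu huB' hx hπB hjoin
    rw [← mem_coe, this]
    exact hπB
  have hdisj : ∀ i ∈ univ.erase i₀, ∀ j ∈ univ.erase i₀, i ≠ j → Disjoint (fib i) (fib j) := by
    intro i _ j _ hij
    rw [Finset.disjoint_left]
    intro u hu hu'
    simp only [fib, mem_filter, mem_univ, true_and] at hu hu'
    exact hij (huniq i j u (π u) (hπ u hu.1).1.ne' hu.2.1 hu'.2.1 hu.2.2 hu'.2.2)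
  have h1 : ∑ i ∈ univ.erase i₀, (b i - 1) ≤ #(β i₀)ᶜ := by
    refine (sum_le_sum fun i hi => hfib i (ne_of_mem_erase hi)).trans ?_
    rw [← card_biUnion hdisj]
    refine card_le_card fun u hu => ?_
    obtain ⟨i, -, hu⟩ := mem_biUnion.1 hu
    rw [mem_compl, ← mem_coe, ← hi₀]
    exact (mem_filter.1 hu).2.1
  rw [card_compl, hcard] at h1
  have h2 : b i₀ ≤ Fintype.card V := by rw [← hcard]; exact card_le_univ _
  have := hb2 i₀
  rw [blockGraphOrder, ← add_sum_erase _ _ (mem_univ i₀)]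
  omega

theorem IsClawFreeBlockGraph.card_eq (h : IsClawFreeBlockGraph G b) (hb : Antitone b)
    (hb2 : ∀ i, 2 ≤ b i) {B₀ : Set V} (hB₀ : IsBlock G B₀) :
    Fintype.card V = blockGraphOrder b := by
  refine le_antisymm ?_ (h.blockGraphOrder_le_card hb2 hB₀)
  have := h.card_le_growth hb hb2 hB₀ univ univ (fun u _ hu => by
    obtain ⟨u', hadj, hd⟩ := exists_adj_depth_eq_add_one h.connected hB₀.nonempty hu
    exact ⟨u', mem_univ _, hadj, by omega⟩) (fun u _ => Or.inr (Or.inl (mem_univ u)))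
  exact this.trans (growth_le _)

/-- A root block with minimal total depth is a centroid. -/
theorem IsClawFreeBlockGraph.exists_centroid (h : IsClawFreeBlockGraph G b)
    (hb2 : ∀ i, 2 ≤ b i) : ∃ B₀, IsBlock G B₀ ∧
      ∀ x, 2 * (behind G B₀ x).ncard ≤ Fintype.card V - 1 := by
  classical
  have hG := h.blockGraph
  have hconn := h.connected
  have hsize := h.two_le_ncard hb2
  obtain ⟨x₀⟩ := hconn.nonempty
  obtain ⟨B', hB', -⟩ := exists_isBlock_of_mem (G := G) x₀
  obtain ⟨B₀, hB₀, hmin⟩ := Set.exists_min_image {B : Set V | IsBlock G B}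
    (fun B => ∑ u, depth G B u) (Set.toFinite _) ⟨B', hB'⟩
  have hB₀ : IsBlock G B₀ := hB₀
  have hne := hB₀.nonempty
  refine ⟨B₀, hB₀, fun x => ?_⟩
  induction hm : depth G B₀ x using Nat.strong_induction_on generalizing x with
  | _ m ih =>
    by_cases hx : x ∈ B₀
    · have hnbr : ∀ u ∈ behind G B₀ x, ∃ a ∈ behind G B₀ x, G.Adj a x ∧
          G.dist u a + 1 ≤ depth G B₀ u := by
        intro u hu
        obtain ⟨a, hadj, hd⟩ := exists_adj_dist_eq_add_one hconn hu.1.symm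
        obtain ⟨q, hq⟩ := hconn.exists_walk_length_eq_dist u a
        have hxq : x ∉ q.support := by
          intro hxq
          have h1 := dist_le (q.takeUntil x hxq)
          have h2 := q.length_takeUntil_le_length hxq
          omega
        refine ⟨a, behind_of_joinedAvoiding hu ⟨q, hxq⟩, hadj, ?_⟩
        obtain ⟨c, hc, hdc⟩ := exists_depth_eq (G := G) hne u
        obtain ⟨q', hq'⟩ := hconn.exists_walk_length_eq_dist u c
        have hxq' : x ∈ q'.support := by
          by_contra hxq'
          exact hu.2 c hc ⟨q', hxq'⟩
        have h1 := dist_le (q'.takeUntil x hxq')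
        have h2 := q'.length_takeUntil_le_length hxq'
        omega
      rcases (behind G B₀ x).eq_empty_or_nonempty with hempty | ⟨u₀, hu₀⟩
      · simp [hempty]
      obtain ⟨a₀, ha₀, hadj₀, -⟩ := hnbr u₀ hu₀
      obtain ⟨B₁, hB₁, ha₁, hx₁⟩ := exists_isBlock_of_adj hadj₀
      have h01 : B₀ ≠ B₁ := by
        rintro rfl
        exact notMem_of_mem_behind ha₀ ha₁
      -- Moving the root from `B₀` to the other block `B₁` at x lowers the depth of everything
      -- behind x, does not raise that of x, and raises the rest by at most one. Minimality of `B₀`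
      -- then gives k ≤ n - (k + 1) for the number k of vertices behind x.
      have hpt : ∀ u, depth G B₁ u + (if u ∈ behind G B₀ x then 1 else 0) ≤
          depth G B₀ u + (if u ∉ insert x (behind G B₀ x) then 1 else 0) := by
        intro u
        by_cases hu : u ∈ behind G B₀ x
        · obtain ⟨a, ha, hadj, hd⟩ := hnbr u hu
          obtain ⟨B, hB, haB, hxB⟩ := exists_isBlock_of_adj hadj
          have hBB : B = B₁ := by
            rcases eq_or_eq_of_mem_isBlock hG h.clawFree hsize hB₀ hB₁ hB hx hx₁ hxB h01
              with rfl | hBB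
            · exact absurd haB (notMem_of_mem_behind ha)
            · exact hBB
          rw [hBB] at haB
          have := depth_le (G := G) (u := u) haB
          rw [if_pos hu]
          omega
        · by_cases hux : u = x
          · subst hux
            rw [depth_eq_zero hx₁, if_neg hu]
            omega
          · rw [if_neg hu, if_pos (by simp [hux, hu])]
            obtain ⟨c, hc, hdc⟩ := exists_depth_eq (G := G) hne u
            have h1 := depth_le (G := G) (u := u) hx₁
            have h2 : G.dist u x ≤ G.dist u c + G.dist c x := hconn.dist_triangle
            have h3 : G.dist c x ≤ 1 := by
              by_cases hcx : c = x
              · simp [hcx]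
              · exact (dist_eq_one_iff_adj.2 (hG _ hB₀ hc hx hcx)).le
            omega
      have hsum := sum_le_sum fun u (_ : u ∈ univ) => hpt u
      rw [sum_add_distrib, sum_add_distrib, ← card_filter, ← card_filter] at hsum
      have hle : ∑ u, depth G B₀ u ≤ ∑ u, depth G B₁ u := hmin B₁ hB₁
      have hK : #{u | u ∈ behind G B₀ x} = (behind G B₀ x).ncard := by
        rw [Set.ncard_eq_toFinset_card']
        congr 1
        ext u; simp
      have hKc : #{u | u ∉ insert x (behind G B₀ x)} =
          Fintype.card V - ((behind G B₀ x).ncard + 1) := by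
        rw [← Set.ncard_insert_of_notMem (a := x) (fun hxx => hxx.1 rfl),
          Set.ncard_eq_toFinset_card', ← card_compl]
        congr 1
        ext u; simp
      rw [hK, hKc] at hsum
      omega
    · obtain ⟨x', hadj, hd⟩ := exists_adj_depth_eq_add_one hconn hne hx
      have h1 := ih _ (by omega) x' rfl
      have h2 := Set.ncard_le_ncard
        (behind_subset hconn hne (mem_behind_parent hconn hG hB₀ hx hadj hd))
      omega

/-- The total size of the subtrees hanging below a closed set of vertices. -/
theorem IsClawFreeBlockGraph.levelSum_le (h : IsClawFreeBlockGraph G b) (hb : Antitone b)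
    (hb2 : ∀ i, 2 ≤ b i) {B₀ : Set V} (hB₀ : IsBlock G B₀) (S : Finset V)
    (hS : ∀ x ∈ S, ∀ u ∈ behind G B₀ x, u ∈ S) :
    levelSum b (Fintype.card V) #S ≤ ∑ x ∈ S, ((behind G B₀ x).ncard + 1) := by
  classical
  have hG := h.blockGraph
  have hconn := h.connected
  have hne := hB₀.nonempty
  set n := Fintype.card V with hn
  set lev : V → ℕ := fun u => #{x ∈ S | IsAbove G B₀ x u} with hlev
  have hlev0 : ∀ u, lev u = 0 ↔ u ∉ S := by
    intro u
    simp only [hlev, card_eq_zero, filter_eq_empty_iff]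
    constructor
    · exact fun h hu => h hu (Or.inl rfl)
    · rintro hu x hx (rfl | hux)
      · exact hu hx
      · exact hu (hS x hx u hux)
  have hpar : ∀ u ∉ B₀, ∃ u', G.Adj u u' ∧ depth G B₀ u' < depth G B₀ u ∧
      lev u' + (if u ∈ S then 1 else 0) ≤ lev u := by
    intro u hu
    obtain ⟨u', hadj, hd⟩ := exists_adj_depth_eq_add_one hconn hne hu
    refine ⟨u', hadj, by omega, ?_⟩
    have hab := fun x => IsAbove.of_parent (x := x) hconn hG hB₀ hu hadj hd
    split_ifs with huS
    · rw [← card_insert_of_notMem (a := u) (by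
        intro hmem
        exact (hab u (mem_filter.1 hmem).2).2 rfl)]
      refine card_le_card fun x hx => ?_
      rcases mem_insert.1 hx with rfl | hx
      · exact mem_filter.2 ⟨huS, Or.inl rfl⟩
      · rw [mem_filter] at hx ⊢
        exact ⟨hx.1, (hab x hx.2).1⟩
    · refine card_le_card fun x hx => ?_
      rw [mem_filter] at hx ⊢
      exact ⟨hx.1, (hab x hx.2).1⟩
  -- The set `lev ≤ j` is closed under parents. A vertex with `lev ≤ j + 1` is in the root block,
  -- has `lev` 0, or has its parent in that set, so one application of `growth b` bounds the next
  -- set.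
  have hA : ∀ j, #{u | lev u ≤ j} ≤ (growth b)^[j] (n - #S) := by
    intro j
    induction j with
    | zero =>
      rw [Function.iterate_zero_apply, hn, ← card_compl]
      refine card_le_card fun u hu => ?_
      rw [mem_filter, Nat.le_zero, hlev0] at hu
      exact mem_compl.2 hu.2
    | succ j ih =>
      rw [Function.iterate_succ_apply']
      refine le_trans ?_ (growth_mono ih)
      refine h.card_le_growth hb hb2 hB₀ _ _ (fun u hu huB => ?_) (fun u hu => ?_)
      · obtain ⟨u', hadj, hd, hl⟩ := hpar u huB
        rw [mem_filter] at hu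
        exact ⟨u', mem_filter.2 ⟨mem_univ _, by omega⟩, hadj, hd⟩
      · rw [mem_filter] at hu
        by_cases huB : u ∈ B₀
        · exact Or.inl huB
        · right
          by_cases huS : u ∈ S
          · right
            obtain ⟨u', hadj, -, hl⟩ := hpar u huB
            rw [if_pos huS] at hl
            exact ⟨u', mem_filter.2 ⟨mem_univ _, by omega⟩, hadj⟩
          · left
            rw [mem_filter, (hlev0 u).2 huS]
            exact ⟨mem_univ _, Nat.zero_le _⟩
  have hsum : ∑ x ∈ S, ((behind G B₀ x).ncard + 1) = ∑ u, lev u := by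
    have h1 : ∀ x, (behind G B₀ x).ncard + 1 = ∑ u, if IsAbove G B₀ x u then 1 else 0 := by
      intro x
      rw [← card_filter, ← Set.ncard_insert_of_notMem (a := x) (fun hxx => hxx.1 rfl),
        Set.ncard_eq_toFinset_card']
      congr 1
      ext u
      simp only [Set.mem_toFinset, Set.mem_insert_iff, mem_filter, mem_univ, true_and, IsAbove,
        eq_comm (a := x)]
    simp_rw [h1, hlev, card_filter]
    exact sum_comm
  rw [hsum, levelSum]
  calc ∑ j ∈ range n, (n - (growth b)^[j] (n - #S))
      ≤ ∑ j ∈ range n, #{u | j < lev u} := sum_le_sum fun j _ => by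
        have h1 : #{u | j < lev u} = n - #{u | lev u ≤ j} := by
          rw [hn, ← card_compl]
          congr 1
          ext u; simp
        rw [h1]
        exact Nat.sub_le_sub_left (hA j) n
    _ = ∑ u, min n (lev u) := sum_card_filter_lt _ _ _
    _ ≤ ∑ u, lev u := sum_le_sum fun u _ => min_le_right _ _

theorem IsClawFreeBlockGraph.le_two_mul_wienerIndex (h : IsClawFreeBlockGraph G b)
    (hb : Antitone b) (hb2 : ∀ i, 2 ≤ b i) :
    ∃ Y : Fin (blockGraphOrder b) → ℕ, Monotone Y ∧
      (∀ i, 2 * Y i ≤ blockGraphOrder b - 1) ∧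
      (∀ k ≤ blockGraphOrder b,
        levelSum b (blockGraphOrder b) k ≤ ∑ i with i.val < k, (Y i + 1)) ∧
      blockGraphOrder b * (blockGraphOrder b - 1) +
        2 * ∑ i, Y i * (blockGraphOrder b - 1 - Y i) ≤ 2 * wienerIndex G := by
  classical
  obtain ⟨B₀, hB₀, hcent⟩ := h.exists_centroid hb2
  have hconn := h.connected
  have hcard := h.card_eq hb hb2 hB₀
  set n := blockGraphOrder b with hn
  let K : V → Finset V := fun x => {u | u ∈ behind G B₀ x}
  have hK : ∀ x u, u ∈ K x ↔ u ∈ behind G B₀ x := fun x u => by simp [K]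
  have hKc : ∀ x, (behind G B₀ x).ncard = #(K x) := by
    intro x
    rw [← Set.ncard_coe_finset]
    congr 1
    ext u
    simp [K]
  let e₀ : Fin n ≃ V := (Fintype.equivFinOfCardEq hcard).symm
  let e : Fin n ≃ V := (Tuple.sort fun i => #(K (e₀ i))).trans e₀
  have hmono : Monotone fun i => #(K (e i)) := Tuple.monotone_sort fun i => #(K (e₀ i))
  refine ⟨fun i => #(K (e i)), hmono, fun i => ?_, fun k hk => ?_, ?_⟩
  · simp only [← hKc, ← hcard]
    exact hcent _
  · have hS := h.levelSum_le hb hb2 hB₀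
      ((univ.filter fun i : Fin n => i.val < k).map e.toEmbedding) (by
        intro x hx u hu
        rw [mem_map_equiv, mem_filter] at hx ⊢
        refine ⟨mem_univ _, ?_⟩
        by_contra hlt
        have h1 := hmono (show e.symm x ≤ e.symm u from by rw [Fin.le_def]; omega)
        simp only [Equiv.apply_symm_apply] at h1
        have h2 : K u ⊂ K x := by
          refine ⟨fun w hw => ?_, fun hsub => ?_⟩
          · exact (hK x w).2 (behind_subset hconn hB₀.nonempty hu ((hK u w).1 hw))
          · exact ((hK u u).1 (hsub ((hK x u).2 hu))).1 rfl
        exact absurd (card_lt_card h2) (not_lt.2 h1))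
    rw [card_map, hcard, sum_map] at hS
    have hfk : #{i : Fin n | i.val < k} = k := by
      rw [Fin.card_filter_val_lt, min_eq_right hk]
    rw [hfk] at hS
    simpa [hKc] using hS
  · have h1 := sum_sum_one_add_card_separating K (fun x hx => ((hK x x).1 hx).1 rfl)
    rw [hcard, ← Equiv.sum_comp e fun x => #(K x) * (n - 1 - #(K x))] at h1
    rw [← h1, two_mul_wienerIndex]
    refine sum_le_sum fun u _ => sum_le_sum fun w _ => ?_
    split_ifs with huw
    · exact Nat.zero_le _
    · exact one_add_card_le_dist hconn K hK huw

end Class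

end SteinerWiener

theorem mainTheorem12 {t : ℕ} (ht : 1 ≤ t) (b : Fin t → ℕ) (hb : Antitone b)
    (hb2 : ∀ i, 2 ≤ b i) :
    (∃ T : SimpleGraph (Fin (t + SteinerWiener.numLeaves b)),
      SteinerWiener.IsGreedyTree T (SteinerWiener.treeDegreeSequence b)) ∧
    ∀ (U : Type*) (T : SimpleGraph U),
      SteinerWiener.IsGreedyTree T (SteinerWiener.treeDegreeSequence b) →
        SteinerWiener.IsClawFreeBlockGraph T.lineGraph b ∧
        ∀ (V : Type*) (G : SimpleGraph V), SteinerWiener.IsClawFreeBlockGraph G b →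
          SteinerWiener.wienerIndex T.lineGraph ≤ SteinerWiener.wienerIndex G := by
  refine ⟨⟨_, SteinerWiener.greedyGraph_isGreedyTree hb hb2⟩, fun U T hT =>
    ⟨hT.isClawFreeBlockGraph_lineGraph ht hb hb2, fun V G hG => ?_⟩⟩
  have := hG.finite
  have := Fintype.ofFinite V
  obtain ⟨X, hX, hXsum, hXW⟩ := hT.two_mul_wienerIndex_lineGraph_le hb2
  obtain ⟨Y, hYmono, hY, hYsum, hYW⟩ := hG.le_two_mul_wienerIndex hb hb2
  have h := SteinerWiener.sum_fin_mul_sub_le_of_partial_sums_le X Y hX hY hYmono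
    fun k hk => (hXsum k).trans (hYsum k hk)
  omega
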